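/- Let $d\in\mathbb N$ and let $\{X_{nj}: n\in\mathbb N,\ j\in\mathbb Z^d\}$ be random variables with mean zero on a probability space $(\Omega,\mathcal F,P)$ such that, for each $n$, the variables $X_{nj}$, $j\in\mathbb Z^d$, are independent. Suppose that for each $n$ there is $H_n>0$ such that, for every $j$, $\mathbb E|e^{zX_{nj}}|<\infty$ for all $z\in\mathbb C$ with $|z|<H_n$ and the cumulant generating function $L_{nj}(z)=\log\mathbb E e^{zX_{nj}}$ (the branch of the logarithm with $L_{nj}(0)=0$) is analytic in the disc $\{|z|<H_n\}$. Let $\gamma_{3nj}=L_{nj}'''(0)$ be the third cumulant of $X_{nj}$. Put $B_n=\sum_{j\in\mathbb Z^d}\operatorname{Var}(X_{nj})$ and assume $B_n<\infty$ for each $n$. Assume that $S_n=\sum_{j\in\mathbb Z^d}X_{nj}$ is well defined as the limit in probability, as $m\to\infty$, of the sums over $j\in[-m,m]^d\cap\mathbb Z^d$. Put $F_n(x)=P(S_n<x\sqrt{B_n})$, and let $\Phi$ be the standard normal distribution function. Suppose that there are constants $c_{nj}\ge 0$ with $|L_{nj}(z)|\le c_{nj}$ for all $n$, $j$ and all $z\in\mathbb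 C$ with $|z|<H_n$, that $B_nH_n^2\to\infty$ as $n\to\infty$, and that $\sum_{j\in\mathbb Z^d}c_{nj}$ is finite for each $n$ and is $O(B_nH_n^2)$ as $n\to\infty$. Then the series $\sum_{j\in\mathbb Z^d}\gamma_{3nj}$ converges absolutely for each $n$ and, for $x\ge 0$ with $x=O\big((H_n\sqrt{B_n})^{1/3}\big)$, $$\frac{1-F_n(x)}{1-\Phi(x)}=\exp\Big\{\frac{x^3}{6B_n^{3/2}}\sum_{j\in\mathbb Z^d}\gamma_{3nj}\Big\}\Big(1+O\Big(\frac{x+1}{H_n\sqrt{B_n}}\Big)\Big)$$ as $n\to\infty$, uniformly in $x$; that is, for every $K$ there are $C$ and $n_0$ such that for all $n\ge n_0$ and all $x$ with $0\le x\le K(H_n\sqrt{B_n})^{1/3}$ the left side equals the exponential times $1+r$ for some real $r$ with $|r|\le C(x+1)/(H_n\sqrt{B_n})$. -/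

import Mathlib

open MeasureTheory ProbabilityTheory Filter Topology Asymptotics

noncomputable section

namespace RandomFieldCramer

variable {Ω : Type*} [MeasurableSpace Ω]

/-- The function `L` is the cumulant generating function `z ↦ log E[exp (z X)]` of `X` on the
open disc of radius `H` of the complex plane: there the exponential moments are finite, and `L`
is the analytic branch of the logarithm of `E[exp (z X)]` that vanishes at `0`. These conditions
determine `L` on the disc; where the principal value of the logarithm of `E[exp (z X)]` is
analytic on the disc, `L` is this principal value. -/
structure IsCumulantGeneratingFunction (X : Ω → ℝ) (P : Measure Ω) (H : ℝ) (L : ℂ → ℂ) :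
    Prop where
  integrable : ∀ z ∈ Metric.ball (0 : ℂ) H,
    Integrable (fun ω => Complex.exp (z * (X ω : ℂ))) P
  analytic : AnalyticOnNhd ℂ L (Metric.ball (0 : ℂ) H)
  map_zero : L 0 = 0
  exp_eq : ∀ z ∈ Metric.ball (0 : ℂ) H,
    Complex.exp (L z) = complexMGF X P z

/-- The cumulant of order `k` of `X`: the `k`-th derivative at `0` of `t ↦ log E[exp (t X)]`. -/
def cumulant (k : ℕ) (X : Ω → ℝ) (P : Measure Ω) : ℝ :=
  iteratedDeriv k (cgf X P) 0

/-- The cube `[-m, m]^d ∩ ℤ^d`. -/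
def cube (d m : ℕ) : Finset (Fin d → ℤ) :=
  Fintype.piFinset fun _ => Finset.Icc (-(m : ℤ)) (m : ℤ)

/-- `S` is the sum of the field `X` over `ℤ^d`: the limit in probability, as `m → ∞`, of the
partial sums over the cubes `[-m, m]^d ∩ ℤ^d`. -/
def IsFieldSum {d : ℕ} (X : (Fin d → ℤ) → Ω → ℝ) (P : Measure Ω) (S : Ω → ℝ) : Prop :=
  TendstoInMeasure P (fun (m : ℕ) (ω : Ω) => ∑ j ∈ cube d m, X j ω) atTop S

/-- The sum over `ℤ^d` of the variances of the field `X`. -/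
def totalVariance {d : ℕ} (X : (Fin d → ℤ) → Ω → ℝ) (P : Measure Ω) : ℝ :=
  ∑' j, Var[X j; P]

/-- The distribution function `x ↦ P(S < x √B)` of the normalized sum (with strict inequality). -/
def normalizedCDF (S : Ω → ℝ) (P : Measure Ω) (B x : ℝ) : ℝ :=
  P.real {ω | S ω < x * √B}

/-- The distribution function `Φ` of the standard normal law. -/
def stdNormalCDF (x : ℝ) : ℝ :=
  cdf (gaussianReal 0 1) x

end RandomFieldCramer

end

namespace RandomFieldCramer

/-! ### Taylor estimates for bounded analytic functions on a disc -/

/-! The proof is Cramér's method of conjugate distributions. Let `μ` be the law of `S / √B`, `T = H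
√B` and `lam = (∑ γ₃) / B ^ (3/2)`. Cauchy's estimates for the functions `L j`, summed against the
bound `∑ c j ≤ M B H ^ 2`, show that the logarithm `k` of the moment generating function of `μ` is
`z ^ 2 / 2 + lam z ^ 3 / 6` up to a remainder of order `z ^ 4 / T ^ 2`, with `lam = O(1 / T)`
(`IsFieldSum.hasCubicExpansion_map`). The moment generating function of the infinite sum is obtained
from finite sums by uniform integrability.

Tilting `μ` by `exp (x y)` gives a law close to the Gaussian with mean `x + lam x ^ 2 / 2` and
variance `1 + lam x`. By Esseen's smoothing inequality the Kolmogorov distance is `O(1 / T)` as long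
as `x ^ 3 = O(T)` (`exists_abs_measureReal_tilted_sub_le`). Undoing the tilt, `μ [x, ∞)` is `exp (k
x)` times the integral of `exp (-x y)` over `[x, ∞)` against the tilted law. For the Gaussian this
integral is `exp (-x ^ 2 / 2)` times a normal tail at a point that differs from `x` only to second
order in `lam x`, and replacing the tilted law by the Gaussian costs `O(exp (-x ^ 2) / T)`. The
lower bound for the Mills ratio turns this into a relative error `O((x + 1) / T)`, and `exp (k x - x
^ 2 / 2)` supplies the cubic exponential (`exists_measureReal_Ici_div_eq`). -/

theorem norm_le_mul_pow_succ_of_hasDerivAt {f f' : ℂ → ℂ} {A r : ℝ} {n : ℕ} (hA : 0 ≤ A)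
    (hf : ∀ z ∈ Metric.ball (0 : ℂ) r, HasDerivAt f (f' z) z) (hf0 : f 0 = 0)
    (hf' : ∀ z ∈ Metric.ball (0 : ℂ) r, ‖f' z‖ ≤ A * ‖z‖ ^ n) :
    ∀ z ∈ Metric.ball (0 : ℂ) r, ‖f z‖ ≤ A * ‖z‖ ^ (n + 1) := by
  intro z hz
  have hsub : Metric.closedBall (0 : ℂ) ‖z‖ ⊆ Metric.ball 0 r :=
    Metric.closedBall_subset_ball (by simpa using hz)
  have h := (convex_closedBall (0 : ℂ) ‖z‖).norm_image_sub_le_of_norm_deriv_le (f := f)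
    (C := A * ‖z‖ ^ n) (x := 0) (y := z)
    (fun w hw => (hf w (hsub hw)).differentiableAt)
    (fun w hw => by
      rw [(hf w (hsub hw)).deriv]
      refine (hf' w (hsub hw)).trans ?_
      have : ‖w‖ ≤ ‖z‖ := by simpa using hw
      gcongr)
    (by simp) (by simp)
  rw [hf0, sub_zero, sub_zero] at h
  calc ‖f z‖ ≤ A * ‖z‖ ^ n * ‖z‖ := h
    _ = A * ‖z‖ ^ (n + 1) := by ring

theorem hasDerivAt_iteratedDeriv_of_analyticOnNhd {L : ℂ → ℂ} {s : Set ℂ}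
    (hL : AnalyticOnNhd ℂ L s) (n : ℕ) {z : ℂ} (hz : z ∈ s) :
    HasDerivAt (iteratedDeriv n L) (iteratedDeriv (n + 1) L z) z := by
  have h : DifferentiableAt ℂ (iteratedDeriv n L) z := by
    rw [iteratedDeriv_eq_iterate]
    exact (hL.iterated_deriv n z hz).differentiableAt
  rw [iteratedDeriv_succ]
  exact h.hasDerivAt

theorem norm_iteratedDeriv_le_of_norm_le {L : ℂ → ℂ} {H c r : ℝ}
    (hL : AnalyticOnNhd ℂ L (Metric.ball 0 H)) (hc : ∀ z ∈ Metric.ball (0 : ℂ) H, ‖L z‖ ≤ c)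
    (hr : 0 < r) (n : ℕ) {z : ℂ} (hz : ‖z‖ + r < H) :
    ‖iteratedDeriv n L z‖ ≤ n.factorial * c / r ^ n := by
  have hsub : Metric.closedBall z r ⊆ Metric.ball 0 H := by
    intro w hw
    rw [mem_closedBall_iff_norm] at hw
    rw [mem_ball_zero_iff]
    have := norm_add_le (w - z) z
    rw [sub_add_cancel] at this
    linarith
  refine Complex.norm_iteratedDeriv_le_of_forall_mem_sphere_norm_le n hr ?_
    fun w hw => hc w (hsub (Metric.sphere_subset_closedBall hw))
  refine DifferentiableOn.diffContOnCl ?_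
  rw [closure_ball _ hr.ne']
  exact (hL.mono hsub).differentiableOn

/-- The remainder of the cubic Taylor polynomial at `0` of a function with a double zero there. -/
noncomputable def cubicRemainder (L : ℂ → ℂ) (z : ℂ) : ℂ :=
  L z - (iteratedDeriv 2 L 0 / 2 * z ^ 2 + iteratedDeriv 3 L 0 / 6 * z ^ 3)

/-- The fourth derivative is bounded by Cauchy's estimate and integrated three times, so the
derivative of the remainder is at most a constant times `‖u‖ ^ 3`. The bound is for increments
because the tilted characteristic function involves `k (x + i t) - k x`, whose error must vanish
linearly in `t`. -/
theorem norm_cubicRemainder_sub_le {L : ℂ → ℂ} {H c : ℝ} (hH : 0 < H) (hc0 : 0 ≤ c)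
    (hL : AnalyticOnNhd ℂ L (Metric.ball 0 H)) (hc : ∀ z ∈ Metric.ball (0 : ℂ) H, ‖L z‖ ≤ c)
    (hL1 : deriv L 0 = 0) {r : ℝ} (hr : r < H / 2) {z w : ℂ} (hz : ‖z‖ ≤ r) (hw : ‖w‖ ≤ r) :
    ‖cubicRemainder L z - cubicRemainder L w‖ ≤ 6144 * c / H ^ 4 * r ^ 3 * ‖z - w‖ := by
  set A : ℝ := 6144 * c / H ^ 4 with hA
  have hA0 : 0 ≤ A := by positivity
  have hsub : Metric.ball (0 : ℂ) (H / 2) ⊆ Metric.ball 0 H :=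
    Metric.ball_subset_ball (by linarith)
  have hd : ∀ n, ∀ z ∈ Metric.ball (0 : ℂ) (H / 2),
      HasDerivAt (iteratedDeriv n L) (iteratedDeriv (n + 1) L z) z :=
    fun n z hz => hasDerivAt_iteratedDeriv_of_analyticOnNhd hL n (hsub hz)
  -- Cauchy's estimate on circles of radius `H / 4` gives `6144 = 4! * 4 ^ 4`.
  have h4 : ∀ z ∈ Metric.ball (0 : ℂ) (H / 2), ‖iteratedDeriv 4 L z‖ ≤ A * ‖z‖ ^ 0 := by
    intro z hz
    rw [mem_ball_zero_iff] at hz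
    refine (norm_iteratedDeriv_le_of_norm_le hL hc (r := H / 4) (by positivity) 4
      (by linarith)).trans (le_of_eq ?_)
    rw [hA]
    norm_num [Nat.factorial]
    field_simp
    ring
  have h3 := norm_le_mul_pow_succ_of_hasDerivAt (f := fun z => iteratedDeriv 3 L z -
    iteratedDeriv 3 L 0) hA0 (fun z hz => (hd 3 z hz).sub_const _) (by simp) h4
  have h2 := norm_le_mul_pow_succ_of_hasDerivAt (f := fun z => iteratedDeriv 2 L z -
    iteratedDeriv 2 L 0 - iteratedDeriv 3 L 0 * z) hA0
    (fun z hz => by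
      have := ((hd 2 z hz).sub_const (iteratedDeriv 2 L 0)).sub
        ((hasDerivAt_id z).const_mul (iteratedDeriv 3 L 0))
      exact this.congr_deriv (by simp)) (by simp) h3
  have h1 := norm_le_mul_pow_succ_of_hasDerivAt (f := fun z => iteratedDeriv 1 L z -
    iteratedDeriv 2 L 0 * z - iteratedDeriv 3 L 0 / 2 * z ^ 2) hA0
    (fun z hz => by
      have := ((hd 1 z hz).sub ((hasDerivAt_id z).const_mul (iteratedDeriv 2 L 0))).sub
        ((hasDerivAt_pow 2 z).const_mul (iteratedDeriv 3 L 0 / 2))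
      refine this.congr_deriv ?_
      push_cast
      ring) (by simp [iteratedDeriv_one, hL1]) h2
  have h0 : ∀ z ∈ Metric.ball (0 : ℂ) (H / 2), HasDerivAt (cubicRemainder L)
      (iteratedDeriv 1 L z - iteratedDeriv 2 L 0 * z - iteratedDeriv 3 L 0 / 2 * z ^ 2) z := by
    intro z hz
    have := (hd 0 z hz).sub (((hasDerivAt_pow 2 z).const_mul (iteratedDeriv 2 L 0 / 2)).add
        ((hasDerivAt_pow 3 z).const_mul (iteratedDeriv 3 L 0 / 6)))
    rw [iteratedDeriv_zero] at this
    refine this.congr_deriv ?_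
    push_cast
    ring
  have hsub' : Metric.closedBall (0 : ℂ) r ⊆ Metric.ball 0 (H / 2) :=
    Metric.closedBall_subset_ball hr
  refine (convex_closedBall (0 : ℂ) r).norm_image_sub_le_of_norm_deriv_le
    (fun u hu => (h0 u (hsub' hu)).differentiableAt) (fun u hu => ?_) (by simpa using hw)
    (by simpa using hz)
  rw [(h0 u (hsub' hu)).deriv]
  refine (h1 u (hsub' hu)).trans ?_
  have : ‖u‖ ≤ r := by simpa using hu
  gcongr

/-! ### Cumulants as Taylor coefficients of the cumulant generating function -/

theorem iteratedDeriv_eq_re_of_forall_eq_re {f : ℂ → ℂ} {g : ℝ → ℝ} {H : ℝ}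
    (hf : AnalyticOnNhd ℂ f (Metric.ball 0 H)) (hg : ∀ t : ℝ, |t| < H → g t = (f t).re) (n : ℕ) :
    ∀ t : ℝ, |t| < H → iteratedDeriv n g t = (iteratedDeriv n f t).re := by
  induction n with
  | zero => simpa using hg
  | succ n ih =>
    intro t ht
    have h : HasDerivAt (fun s : ℝ => (iteratedDeriv n f s).re) (iteratedDeriv (n + 1) f t).re t :=
      (hasDerivAt_iteratedDeriv_of_analyticOnNhd hf n (by simpa using ht)).real_of_complex
    rw [iteratedDeriv_succ]
    refine (h.congr_of_eventuallyEq ?_).deriv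
    have : ∀ᶠ s : ℝ in 𝓝 t, |s| < H := continuous_abs.continuousAt.eventually_lt_const ht
    filter_upwards [this] with s hs using ih s hs

variable {Ω : Type*} [MeasurableSpace Ω]

namespace IsCumulantGeneratingFunction

variable {X : Ω → ℝ} {P : Measure Ω} {H : ℝ} {L : ℂ → ℂ}

theorem cgf_eq_re (h : IsCumulantGeneratingFunction X P H L) {t : ℝ} (ht : |t| < H) :
    cgf X P t = (L t).re := by
  have h1 := h.exp_eq t (by simpa using ht)
  rw [complexMGF_ofReal] at h1
  have h2 : Real.exp (L t).re = mgf X P t := by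
    rw [← Complex.norm_exp, h1, Complex.norm_real, Real.norm_of_nonneg mgf_nonneg]
  rw [cgf, ← h2, Real.log_exp]

/-- At real points `exp (L t)` is real, so `sin (Im L t) = 0`; by continuity `Im L t` stays below `1
< π` near `0`, which leaves only the value `0`. -/
theorem eventually_im_eq_zero (h : IsCumulantGeneratingFunction X P H L) (hH : 0 < H) :
    ∃ δ, 0 < δ ∧ δ ≤ H ∧ ∀ t : ℝ, |t| < δ → (L t).im = 0 := by
  have hcont : ContinuousAt (fun t : ℝ => (L t).im) 0 := by
    have : ContinuousAt L ((0 : ℝ) : ℂ) := by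
      simpa using (h.analytic 0 (by simpa using hH)).continuousAt
    exact Complex.continuous_im.continuousAt.comp
      (this.comp Complex.continuous_ofReal.continuousAt)
  have h0 : (L ((0 : ℝ) : ℂ)).im = 0 := by simp [h.map_zero]
  obtain ⟨δ, hδ, hδ'⟩ := Metric.continuousAt_iff.1 hcont 1 one_pos
  refine ⟨min δ H, lt_min hδ hH, min_le_right _ _, fun t ht => ?_⟩
  have h1 : |(L t).im| < 1 := by
    have := hδ' (x := t) (by simpa [Real.dist_eq] using ht.trans_le (min_le_left _ _))
    rwa [h0, Real.dist_eq, sub_zero] at this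
  have h2 := h.exp_eq t (by simpa using ht.trans_le (min_le_right _ _))
  rw [complexMGF_ofReal] at h2
  have h3 := congrArg Complex.im h2
  rw [Complex.exp_im, Complex.ofReal_im, mul_eq_zero] at h3
  have h4 := h3.resolve_left (Real.exp_pos _).ne'
  have := abs_lt.1 h1
  exact (Real.sin_eq_zero_iff_of_lt_of_lt (by linarith [Real.pi_gt_three])
    (by linarith [Real.pi_gt_three])).1 h4

theorem iteratedDeriv_eq (h : IsCumulantGeneratingFunction X P H L) (hH : 0 < H) (n : ℕ) :
    iteratedDeriv n L 0 = ((iteratedDeriv n (cgf X P) 0 : ℝ) : ℂ) := by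
  obtain ⟨δ, hδ, hδH, him⟩ := h.eventually_im_eq_zero hH
  have hre := iteratedDeriv_eq_re_of_forall_eq_re h.analytic (fun t ht => h.cgf_eq_re ht) n 0
    (by simpa using hH)
  -- The imaginary part of `L` is the real part of `-i L`, so the lemma on real parts also shows
  -- that the derivatives of `L` at `0` are real.
  have hanal : AnalyticOnNhd ℂ (fun z => -Complex.I * L z) (Metric.ball 0 δ) :=
    fun z hz => analyticAt_const.mul (h.analytic z (Metric.ball_subset_ball hδH hz))
  have him' := iteratedDeriv_eq_re_of_forall_eq_re hanal (g := fun _ => 0)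
    (fun t ht => by simp [him t ht]) n 0 (by simpa using hδ)
  rw [Complex.ofReal_zero] at hre him'
  have hsmul : iteratedDeriv n (fun z => -Complex.I * L z) 0 =
      -Complex.I * iteratedDeriv n L 0 := by
    refine iteratedDeriv_const_mul_field _ _
  rw [hsmul] at him'
  have hconst : iteratedDeriv n (fun _ : ℝ => (0 : ℝ)) 0 = 0 := by
    simp
  rw [hconst] at him'
  apply Complex.ext
  · rw [hre, Complex.ofReal_re]
  · simpa using him'.symm

theorem zero_mem_interior (h : IsCumulantGeneratingFunction X P H L) (hH : 0 < H) :
    0 ∈ interior (integrableExpSet X P) := by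
  rw [mem_interior_iff_mem_nhds]
  have : ∀ᶠ s : ℝ in 𝓝 0, |s| < H := continuous_abs.continuousAt.eventually_lt_const (by simpa)
  filter_upwards [this] with s hs
  have h1 := (h.integrable s (by simpa using hs)).norm
  refine h1.congr (ae_of_all _ fun ω => ?_)
  simp [Complex.norm_exp]

theorem deriv_eq_zero [IsProbabilityMeasure P] (h : IsCumulantGeneratingFunction X P H L)
    (hH : 0 < H) (hmean : ∫ ω, X ω ∂P = 0) : deriv L 0 = 0 := by
  rw [← iteratedDeriv_one, h.iteratedDeriv_eq hH, iteratedDeriv_one,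
    deriv_cgf_zero (h.zero_mem_interior hH)]
  simp [hmean]

theorem iteratedDeriv_two_eq [IsProbabilityMeasure P] (h : IsCumulantGeneratingFunction X P H L)
    (hH : 0 < H) : iteratedDeriv 2 L 0 = (Var[X; P] : ℂ) := by
  rw [h.iteratedDeriv_eq hH, ← variance_tilted_mul (h.zero_mem_interior hH)]
  simp

theorem iteratedDeriv_three_eq (h : IsCumulantGeneratingFunction X P H L)
    (hH : 0 < H) : iteratedDeriv 3 L 0 = (cumulant 3 X P : ℂ) :=
  h.iteratedDeriv_eq hH 3

theorem abs_cumulant_three_le (h : IsCumulantGeneratingFunction X P H L) (hH : 0 < H) {c : ℝ}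
    (hc : ∀ z : ℂ, ‖z‖ < H → ‖L z‖ ≤ c) : |cumulant 3 X P| ≤ 48 * c / H ^ 3 := by
  have := norm_iteratedDeriv_le_of_norm_le h.analytic (c := c) (r := H / 2)
    (fun z hz => hc z (by simpa using hz)) (by positivity) 3 (z := 0) (by simp; linarith)
  rw [h.iteratedDeriv_three_eq hH, Complex.norm_real, Real.norm_eq_abs] at this
  refine this.trans (le_of_eq ?_)
  norm_num [Nat.factorial]
  field_simp
  ring

end IsCumulantGeneratingFunction

/-! ### The Fejér kernel -/

/-- The Fejér kernel, up to normalization: the Fourier transform of the triangular function. -/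
noncomputable def fejerKernel (s : ℝ) : ℝ :=
  ∫ t in (-1 : ℝ)..1, (1 - |t|) * Real.cos (t * s)

/-- This closed form, from antiderivatives on each half of the interval, is the source of both the
nonnegativity and the quadratic decay of the kernel. -/
theorem sq_mul_fejerKernel (s : ℝ) : s ^ 2 * fejerKernel s = 2 * (1 - Real.cos s) := by
  rcases eq_or_ne s 0 with rfl | hs
  · simp
  have hint : ∀ a b : ℝ, IntervalIntegrable (fun t : ℝ => (1 - |t|) * Real.cos (t * s))
      volume a b := fun a b => Continuous.intervalIntegrable (by fun_prop) _ _
  have hsin : ∀ t : ℝ, HasDerivAt (fun t : ℝ => Real.sin (t * s)) (Real.cos (t * s) * s) t :=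
    fun t => (((hasDerivAt_id t).mul_const s).sin).congr_deriv (by simp)
  have hcos : ∀ t : ℝ, HasDerivAt (fun t : ℝ => Real.cos (t * s)) (-Real.sin (t * s) * s) t :=
    fun t => (((hasDerivAt_id t).mul_const s).cos).congr_deriv (by simp)
  have h1 : ∫ t in (-1 : ℝ)..0, (1 - |t|) * Real.cos (t * s) = (1 - Real.cos s) / s ^ 2 := by
    have : ∫ t in (-1 : ℝ)..0, (1 - |t|) * Real.cos (t * s) =
        ∫ t in (-1 : ℝ)..0, (1 + t) * Real.cos (t * s) := by
      refine intervalIntegral.integral_congr fun t ht => ?_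
      rw [Set.uIcc_of_le (by norm_num)] at ht
      simp only [abs_of_nonpos ht.2, sub_neg_eq_add]
    rw [this, intervalIntegral.integral_eq_sub_of_hasDerivAt
      (f := fun t => (1 + t) * Real.sin (t * s) / s + Real.cos (t * s) / s ^ 2)]
    · simp
      ring
    · intro t _
      have := ((((hasDerivAt_id t).const_add 1).mul (hsin t)).div_const s).add
        ((hcos t).div_const (s ^ 2))
      refine this.congr_deriv ?_
      simp only [id]
      field_simp
      ring
    · exact Continuous.intervalIntegrable (by fun_prop) _ _
  have h2 : ∫ t in (0 : ℝ)..1, (1 - |t|) * Real.cos (t * s) = (1 - Real.cos s) / s ^ 2 := by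
    have : ∫ t in (0 : ℝ)..1, (1 - |t|) * Real.cos (t * s) =
        ∫ t in (0 : ℝ)..1, (1 - t) * Real.cos (t * s) := by
      refine intervalIntegral.integral_congr fun t ht => ?_
      rw [Set.uIcc_of_le (by norm_num)] at ht
      simp only [abs_of_nonneg ht.1]
    rw [this, intervalIntegral.integral_eq_sub_of_hasDerivAt
      (f := fun t => (1 - t) * Real.sin (t * s) / s - Real.cos (t * s) / s ^ 2)]
    · simp
      ring
    · intro t _
      have := ((((hasDerivAt_id t).const_sub 1).mul (hsin t)).div_const s).sub
        ((hcos t).div_const (s ^ 2))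
      refine this.congr_deriv ?_
      simp only [id]
      field_simp
      ring
    · exact Continuous.intervalIntegrable (by fun_prop) _ _
  rw [fejerKernel, ← intervalIntegral.integral_add_adjacent_intervals (hint _ 0) (hint _ _), h1, h2]
  field_simp
  ring

theorem fejerKernel_zero : fejerKernel 0 = 1 := by
  have h1 : ∫ t in (-1 : ℝ)..0, (1 - |t|) = 1 / 2 := by
    rw [intervalIntegral.integral_congr (g := fun t => 1 + t) fun t ht => ?_]
    · rw [intervalIntegral.integral_add (by simp) (by simp)]
      norm_num
    · rw [Set.uIcc_of_le (by norm_num)] at ht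
      simp only [abs_of_nonpos ht.2, sub_neg_eq_add]
  have h2 : ∫ t in (0 : ℝ)..1, (1 - |t|) = 1 / 2 := by
    rw [intervalIntegral.integral_congr (g := fun t => 1 - t) fun t ht => ?_]
    · rw [intervalIntegral.integral_sub (by simp) (by simp)]
      norm_num
    · rw [Set.uIcc_of_le (by norm_num)] at ht
      simp only [abs_of_nonneg ht.1]
  have hint : ∀ a b : ℝ, IntervalIntegrable (fun t : ℝ => 1 - |t|) volume a b :=
    fun a b => Continuous.intervalIntegrable (by fun_prop) _ _
  simp only [fejerKernel, mul_zero, Real.cos_zero, mul_one]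
  rw [← intervalIntegral.integral_add_adjacent_intervals (hint _ 0) (hint _ _), h1, h2]
  norm_num

theorem fejerKernel_nonneg (s : ℝ) : 0 ≤ fejerKernel s := by
  rcases eq_or_ne s 0 with rfl | hs
  · simp [fejerKernel_zero]
  have h := sq_mul_fejerKernel s
  have h1 : 0 ≤ s ^ 2 * fejerKernel s := by
    rw [h]
    linarith [Real.cos_le_one s]
  exact nonneg_of_mul_nonneg_right h1 (by positivity)

theorem fejerKernel_neg (s : ℝ) : fejerKernel (-s) = fejerKernel s := by
  simp [fejerKernel]

theorem continuous_fejerKernel : Continuous fejerKernel := by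
  unfold fejerKernel
  exact intervalIntegral.continuous_parametric_intervalIntegral_of_continuous' (by fun_prop) _ _

theorem fejerKernel_le (s : ℝ) : fejerKernel s ≤ 5 * (1 + s ^ 2)⁻¹ := by
  rw [← div_eq_mul_inv, le_div_iff₀ (by positivity)]
  have h1 : fejerKernel s ≤ fejerKernel 0 := by
    refine intervalIntegral.integral_mono_on (by norm_num)
      (Continuous.intervalIntegrable (by fun_prop) _ _)
      (Continuous.intervalIntegrable (by fun_prop) _ _) fun t ht => ?_
    have : |t| ≤ 1 := abs_le.2 ht
    simp only [mul_zero, Real.cos_zero]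
    exact mul_le_mul_of_nonneg_left (Real.cos_le_one _) (by linarith)
  rw [fejerKernel_zero] at h1
  have h2 := sq_mul_fejerKernel s
  have h3 := Real.neg_one_le_cos s
  linarith

theorem integrable_fejerKernel : Integrable fejerKernel := by
  refine (integrable_inv_one_add_sq.const_mul 5).mono'
    continuous_fejerKernel.aestronglyMeasurable (ae_of_all _ fun s => ?_)
  rw [Real.norm_of_nonneg (fejerKernel_nonneg s)]
  exact fejerKernel_le s

theorem integral_fejerKernel_pos : 0 < ∫ s, fejerKernel s := by
  rw [integral_pos_iff_support_of_nonneg fejerKernel_nonneg integrable_fejerKernel]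
  exact continuous_fejerKernel.isOpen_support.measure_pos _ ⟨0, by simp [fejerKernel_zero]⟩

/-- With a quarter of the mass outside the window, the supremum enters the smoothing estimate with
coefficient `1 / 3 < 1` and can be absorbed. -/
theorem exists_integral_fejerKernel_compl_le :
    ∃ a : ℝ, 0 < a ∧ ∫ s in (Set.Icc (-a) a)ᶜ, fejerKernel s ≤ (∫ s, fejerKernel s) / 4 := by
  have hlim : Tendsto (fun a : ℝ => ∫ s in Set.Icc (-a) a, fejerKernel s) atTop
      (𝓝 (∫ s, fejerKernel s)) := by
    have hcover := aecover_Icc (μ := volume) tendsto_neg_atTop_atBot (tendsto_id (α := ℝ))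
    exact hcover.integral_tendsto_of_countably_generated integrable_fejerKernel
  have hc := integral_fejerKernel_pos
  have hev := hlim.eventually (lt_mem_nhds (show (∫ s, fejerKernel s) * (3 / 4) <
    ∫ s, fejerKernel s by linarith))
  obtain ⟨a, ha, ha0⟩ := (hev.and (eventually_gt_atTop 0)).exists
  refine ⟨a, ha0, ?_⟩
  have := integral_add_compl (μ := volume) (measurableSet_Icc (a := -a) (b := a))
    integrable_fejerKernel
  linarith

theorem integral_cexp_mul_I {t : ℝ} (ht : t ≠ 0) (a b : ℝ) :
    ∫ s in a..b, Complex.exp (t * s * Complex.I) =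
      (Complex.exp (t * b * Complex.I) - Complex.exp (t * a * Complex.I)) / (t * Complex.I) := by
  have h : (t * Complex.I : ℂ) ≠ 0 := by simp [ht]
  have := integral_exp_mul_complex (a := a) (b := b) h
  rw [mul_right_comm (t : ℂ) b, mul_right_comm (t : ℂ) a, ← this]
  refine intervalIntegral.integral_congr fun s _ => ?_
  simp only [mul_right_comm]

theorem norm_cexp_sub_div_le (t a b : ℝ) :
    ‖(Complex.exp (t * b * Complex.I) - Complex.exp (t * a * Complex.I)) / (t * Complex.I)‖ ≤
      |b - a| := by
  rcases eq_or_ne t 0 with rfl | ht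
  · simp
  rw [← integral_cexp_mul_I ht]
  have := intervalIntegral.norm_integral_le_of_norm_le_const (a := a) (b := b) (C := 1)
    (f := fun s : ℝ => Complex.exp (t * s * Complex.I)) fun s _ => by
      rw [← Complex.ofReal_mul, Complex.norm_exp_ofReal_mul_I]
  simpa using this

theorem integral_fejerKernel_eq_re (a b : ℝ) :
    ∫ s in a..b, fejerKernel s =
      (∫ t in (-1 : ℝ)..1, ((1 - |t| : ℝ) : ℂ) *
        ((Complex.exp (t * b * Complex.I) - Complex.exp (t * a * Complex.I)) /
          (t * Complex.I))).re := by
  have hcont : Continuous (Function.uncurry fun (s t : ℝ) =>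
      ((1 - |t| : ℝ) : ℂ) * Complex.exp (t * s * Complex.I)) := by
    unfold Function.uncurry
    fun_prop
  have h1 : ∀ s : ℝ, fejerKernel s =
      (∫ t in (-1 : ℝ)..1, ((1 - |t| : ℝ) : ℂ) * Complex.exp (t * s * Complex.I)).re := by
    intro s
    rw [fejerKernel, ← Complex.reCLM_apply, ← ContinuousLinearMap.intervalIntegral_comp_comm]
    · refine intervalIntegral.integral_congr fun t _ => ?_
      simp only [Complex.reCLM_apply, Complex.re_ofReal_mul]
      rw [← Complex.ofReal_mul, Complex.exp_ofReal_mul_I_re]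
    · exact Continuous.intervalIntegrable (by fun_prop) _ _
  have h2 : ∫ s in a..b, fejerKernel s = (∫ s in a..b, ∫ t in (-1 : ℝ)..1,
      ((1 - |t| : ℝ) : ℂ) * Complex.exp (t * s * Complex.I)).re := by
    rw [← Complex.reCLM_apply, ← ContinuousLinearMap.intervalIntegral_comp_comm]
    · exact intervalIntegral.integral_congr fun s _ => h1 s
    · exact Continuous.intervalIntegrable
        (intervalIntegral.continuous_parametric_intervalIntegral_of_continuous' hcont _ _) _ _
  rw [h2]
  congr 1
  rw [intervalIntegral_intervalIntegral_swap (by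
    exact (hcont.continuousOn.integrableOn_compact
      (isCompact_uIcc.prod isCompact_uIcc)).mono_set
      (Set.prod_mono Set.uIoc_subset_uIcc Set.uIoc_subset_uIcc))]
  refine intervalIntegral.integral_congr_ae ?_
  -- At `t = 0` the quotient is `0` by convention rather than `b - a`; a single point does not
  -- affect the integral.
  have : ∀ᵐ t : ℝ, t ≠ 0 := by simp [ae_iff]
  filter_upwards [this] with t ht _
  rw [intervalIntegral.integral_const_mul, integral_cexp_mul_I ht]

/-! ### Esseen's smoothing inequality -/

/-- Fubini: both sides integrate the kernel over the pairs `(y, s)` with `y + s / T ≤ x`. -/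
theorem integral_fejerKernel_Iic_comp (μ : Measure ℝ) [IsProbabilityMeasure μ] {T : ℝ} (hT : 0 < T)
    (x : ℝ) :
    ∫ y, (∫ s in Set.Iic (T * (x - y)), fejerKernel s) ∂μ =
      ∫ s, fejerKernel s * μ.real (Set.Iic (x - s / T)) := by
  have hset : MeasurableSet {p : ℝ × ℝ | p.2 ≤ T * (x - p.1)} :=
    measurableSet_le measurable_snd (by fun_prop)
  have hint : Integrable (Function.uncurry fun (y s : ℝ) =>
      (Set.Iic (T * (x - y))).indicator fejerKernel s) (μ.prod volume) := by
    have h1 : Integrable (fun p : ℝ × ℝ => fejerKernel p.2) (μ.prod volume) :=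
      integrable_fejerKernel.comp_snd μ
    exact h1.indicator hset
  have h1 : ∀ y, ∫ s in Set.Iic (T * (x - y)), fejerKernel s =
      ∫ s, (Set.Iic (T * (x - y))).indicator fejerKernel s :=
    fun y => (integral_indicator measurableSet_Iic).symm
  simp_rw [h1]
  rw [integral_integral_swap hint]
  refine integral_congr_ae (ae_of_all _ fun s => ?_)
  have h2 : ∀ y, (Set.Iic (T * (x - y))).indicator fejerKernel s =
      (Set.Iic (x - s / T)).indicator (fun _ => fejerKernel s) y := by
    intro y
    have : s ≤ T * (x - y) ↔ y ≤ x - s / T := by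
      rw [mul_comm, ← div_le_iff₀ hT]
      constructor <;> intro h <;> linarith
    simp only [Set.indicator, Set.mem_Iic, this]
  simp_rw [h2]
  rw [integral_indicator measurableSet_Iic, setIntegral_const, smul_eq_mul, mul_comm]

theorem integrable_fejerKernel_Iic_comp (μ : Measure ℝ) [IsProbabilityMeasure μ] (T x : ℝ) :
    Integrable (fun y => ∫ s in Set.Iic (T * (x - y)), fejerKernel s) μ := by
  have hset : MeasurableSet {p : ℝ × ℝ | p.2 ≤ T * (x - p.1)} :=
    measurableSet_le measurable_snd (by fun_prop)
  have h1 : Integrable (fun p : ℝ × ℝ => fejerKernel p.2) (μ.prod volume) :=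
    integrable_fejerKernel.comp_snd μ
  refine (h1.indicator hset).integral_prod_left.congr (ae_of_all _ fun y => ?_)
  simp only
  rw [← integral_indicator measurableSet_Iic]
  rfl

/-- The integrand in the inversion formula for the smoothed distribution function. -/
noncomputable def inversionIntegrand (T x t : ℝ) (φ : ℂ) : ℂ :=
  ((1 - |t| : ℝ) : ℂ) * (Complex.exp (t * (T * x : ℝ) * Complex.I) * (φ - 1) / (t * Complex.I))

theorem inversionIntegrand_cexp (T x t y : ℝ) :
    inversionIntegrand T x t (Complex.exp ((-(t * T) : ℝ) * y * Complex.I)) =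
    ((1 - |t| : ℝ) : ℂ) *
        ((Complex.exp (t * (T * (x - y) : ℝ) * Complex.I) -
          Complex.exp (t * (T * x : ℝ) * Complex.I)) / (t * Complex.I)) := by
  rw [inversionIntegrand, mul_sub, mul_one, ← Complex.exp_add]
  congr 5
  push_cast
  ring

/-- Subtracting `1` from the characteristic function cancels the singularity `1 / t`: the integrand
is bounded by `|T| |y|`, so a first moment suffices for Fubini. -/
theorem integrable_inversionIntegrand (μ : Measure ℝ) [IsProbabilityMeasure μ]
    (hμ : Integrable (fun y => y) μ) (T x : ℝ) :
    Integrable (Function.uncurry fun t y : ℝ =>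
      inversionIntegrand T x t (Complex.exp ((-(t * T) : ℝ) * y * Complex.I)))
      ((volume.restrict (Set.uIoc (-1 : ℝ) 1)).prod μ) := by
  rw [Set.uIoc_of_le (by norm_num)]
  have h1 : Integrable (fun p : ℝ × ℝ => |T| * |p.2|)
      ((volume.restrict (Set.Ioc (-1 : ℝ) 1)).prod μ) :=
    (hμ.abs.comp_snd _).const_mul _
  refine h1.mono' ?_ ?_
  · refine Measurable.aestronglyMeasurable ?_
    unfold Function.uncurry inversionIntegrand
    fun_prop
  · have h2 : ∀ᵐ p ∂((volume.restrict (Set.Ioc (-1 : ℝ) 1)).prod μ),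
        p.1 ∈ Set.Ioc (-1 : ℝ) 1 :=
      Measure.quasiMeasurePreserving_fst.ae (ae_restrict_mem measurableSet_Ioc)
    filter_upwards [h2] with p hp
    have h3 : |p.1| ≤ 1 := abs_le.2 ⟨hp.1.le, hp.2⟩
    simp only [Function.uncurry]
    rw [inversionIntegrand_cexp, norm_mul]
    have h4 : ‖((1 - |p.1| : ℝ) : ℂ)‖ ≤ 1 := by
      rw [Complex.norm_real, Real.norm_of_nonneg (by linarith)]
      linarith [abs_nonneg p.1]
    refine (mul_le_mul h4 (norm_cexp_sub_div_le _ _ _) (norm_nonneg _) zero_le_one).trans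
      (le_of_eq ?_)
    rw [one_mul, ← abs_mul, ← abs_neg (T * p.2)]
    congr 1
    ring

theorem integral_inversionIntegrand (μ : Measure ℝ) [IsProbabilityMeasure μ] {T t : ℝ} (x : ℝ) :
    ∫ y, inversionIntegrand T x t (Complex.exp ((-(t * T) : ℝ) * y * Complex.I)) ∂μ =
      inversionIntegrand T x t (charFun μ (-(t * T))) := by
  have hint : Integrable (fun y : ℝ => Complex.exp ((-(t * T) : ℝ) * y * Complex.I)) μ := by
    refine Integrable.of_bound (C := 1) (by fun_prop) (ae_of_all _ fun y => ?_)
    rw [← Complex.ofReal_mul, Complex.norm_exp_ofReal_mul_I]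
  simp only [inversionIntegrand]
  rw [integral_const_mul, integral_div, integral_const_mul, integral_sub hint (by simp),
    charFun_apply_real]
  simp

/-- The subtracted term is the smoothed distribution function of the point mass at `0`; it cancels
when two laws are compared. -/
theorem integral_fejerKernel_Iic_sub (μ : Measure ℝ) [IsProbabilityMeasure μ]
    (hμ : Integrable (fun y => y) μ) (T x : ℝ) :
    ∫ y, (∫ s in Set.Iic (T * (x - y)), fejerKernel s) ∂μ -
        ∫ s in Set.Iic (T * x), fejerKernel s =
      (∫ t in (-1 : ℝ)..1, inversionIntegrand T x t (charFun μ (-(t * T)))).re := by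
  have hint := integrable_inversionIntegrand μ hμ T x
  have h1 : ∀ y, (∫ s in Set.Iic (T * (x - y)), fejerKernel s) -
      ∫ s in Set.Iic (T * x), fejerKernel s = (∫ t in (-1 : ℝ)..1,
        inversionIntegrand T x t (Complex.exp ((-(t * T) : ℝ) * y * Complex.I))).re := by
    intro y
    rw [intervalIntegral.integral_Iic_sub_Iic integrable_fejerKernel.integrableOn
      integrable_fejerKernel.integrableOn, integral_fejerKernel_eq_re]
    simp_rw [inversionIntegrand_cexp]
  have h2 : ∫ y, ((∫ s in Set.Iic (T * (x - y)), fejerKernel s) -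
      ∫ s in Set.Iic (T * x), fejerKernel s) ∂μ =
      ∫ y, (∫ s in Set.Iic (T * (x - y)), fejerKernel s) ∂μ -
        ∫ s in Set.Iic (T * x), fejerKernel s := by
    rw [integral_sub (integrable_fejerKernel_Iic_comp μ T x) (integrable_const _)]
    simp
  rw [← h2]
  simp_rw [h1]
  have h3 : ∀ t, inversionIntegrand T x t (charFun μ (-(t * T))) =
      ∫ y, inversionIntegrand T x t (Complex.exp ((-(t * T) : ℝ) * y * Complex.I)) ∂μ :=
    fun t => (integral_inversionIntegrand μ x).symm
  simp_rw [h3]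
  rw [intervalIntegral_integral_swap hint]
  have h4 : Integrable (fun y : ℝ => ∫ t in (-1 : ℝ)..1,
      inversionIntegrand T x t (Complex.exp ((-(t * T) : ℝ) * y * Complex.I))) μ := by
    have := hint.integral_prod_right
    simpa [intervalIntegral.integral_of_le, Set.uIoc_of_le] using this
  exact integral_re (𝕜 := ℂ) h4

theorem abs_integral_fejerKernel_mul_sub_le (μ ν : Measure ℝ) [IsProbabilityMeasure μ]
    [IsProbabilityMeasure ν] (hμ : Integrable (fun y => y) μ) (hν : Integrable (fun y => y) ν)
    {T : ℝ} (hT : 0 < T) {g : ℝ → ℝ} (hg : Integrable g)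
    (hφ : ∀ t, |t| ≤ T → ‖charFun μ t - charFun ν t‖ ≤ |t| * g t) (hg0 : ∀ t, 0 ≤ g t) (x : ℝ) :
    |∫ s, fejerKernel s * (μ.real (Set.Iic (x - s / T)) - ν.real (Set.Iic (x - s / T)))| ≤
      ∫ t, g t := by
  have hFint : ∀ ρ : Measure ℝ, [IsProbabilityMeasure ρ] →
      Integrable fun s => fejerKernel s * ρ.real (Set.Iic (x - s / T)) := by
    intro ρ _
    refine integrable_fejerKernel.mul_bdd (c := 1) ?_ (ae_of_all _ fun s => ?_)
    · have hmono : Monotone fun y => ρ.real (Set.Iic y) :=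
        fun a b hab => measureReal_mono (Set.Iic_subset_Iic.2 hab)
      exact (hmono.measurable.comp
        (by fun_prop : Measurable fun s : ℝ => x - s / T)).aestronglyMeasurable
    · rw [Real.norm_of_nonneg measureReal_nonneg]
      exact measureReal_le_one
  have hI : ∀ ρ : Measure ℝ, [IsProbabilityMeasure ρ] → Integrable (fun y => y) ρ →
      IntervalIntegrable (fun t => inversionIntegrand T x t (charFun ρ (-(t * T))))
        volume (-1) 1 := by
    intro ρ _ hρ
    rw [intervalIntegrable_iff]
    refine (integrable_inversionIntegrand ρ hρ T x).integral_prod_left.congr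
      (ae_of_all _ fun t => ?_)
    exact integral_inversionIntegrand ρ x
  have h1 : ∫ s, fejerKernel s * (μ.real (Set.Iic (x - s / T)) - ν.real (Set.Iic (x - s / T))) =
      (∫ t in (-1 : ℝ)..1, (inversionIntegrand T x t (charFun μ (-(t * T))) -
        inversionIntegrand T x t (charFun ν (-(t * T))))).re := by
    rw [intervalIntegral.integral_sub (hI μ hμ) (hI ν hν), Complex.sub_re,
      ← integral_fejerKernel_Iic_sub μ hμ, ← integral_fejerKernel_Iic_sub ν hν,
      integral_fejerKernel_Iic_comp μ hT, integral_fejerKernel_Iic_comp ν hT]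
    simp_rw [mul_sub]
    rw [integral_sub (hFint μ) (hFint ν)]
    ring
  have hg' : Integrable fun t => T * g (-T * t) :=
    (hg.comp_mul_left' (neg_ne_zero.2 hT.ne')).const_mul T
  rw [h1]
  refine (Complex.abs_re_le_norm _).trans ?_
  calc ‖∫ t in (-1 : ℝ)..1, (inversionIntegrand T x t (charFun μ (-(t * T))) -
        inversionIntegrand T x t (charFun ν (-(t * T))))‖
      ≤ ∫ t in (-1 : ℝ)..1, T * g (-T * t) := by
        refine intervalIntegral.norm_integral_le_of_norm_le (by norm_num) ?_
          hg'.intervalIntegrable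
        have hne : ∀ᵐ t : ℝ, t ≠ 0 := by simp [ae_iff]
        filter_upwards [hne] with t ht0 ht
        have h3 : |t| ≤ 1 := abs_le.2 ⟨ht.1.le, ht.2⟩
        have h4 : ‖((1 - |t| : ℝ) : ℂ)‖ ≤ 1 := by
          rw [Complex.norm_real, Real.norm_of_nonneg (by linarith)]
          linarith [abs_nonneg t]
        have h5 : inversionIntegrand T x t (charFun μ (-(t * T))) -
            inversionIntegrand T x t (charFun ν (-(t * T))) =
            ((1 - |t| : ℝ) : ℂ) * (Complex.exp (t * (T * x : ℝ) * Complex.I) *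
              (charFun μ (-(t * T)) - charFun ν (-(t * T))) / (t * Complex.I)) := by
          simp only [inversionIntegrand]
          ring
        have h6 := hφ (-(t * T)) (by
          rw [abs_neg, abs_mul, abs_of_pos hT]
          exact mul_le_of_le_one_left hT.le h3)
        have h7 : 0 < |t| := abs_pos.2 ht0
        rw [h5, norm_mul, norm_div, norm_mul, ← Complex.ofReal_mul,
          Complex.norm_exp_ofReal_mul_I, one_mul, norm_mul, Complex.norm_I, mul_one,
          Complex.norm_real t, Real.norm_eq_abs t]
        refine (mul_le_of_le_one_left (by positivity) h4).trans ?_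
        rw [div_le_iff₀ h7]
        refine h6.trans (le_of_eq ?_)
        rw [abs_neg, abs_mul, abs_of_pos hT, neg_mul, mul_comm T t]
        ring
    _ ≤ ∫ t, T * g (-T * t) := by
        rw [intervalIntegral.integral_of_le (by norm_num)]
        exact setIntegral_le_integral hg' (ae_of_all _ fun t => mul_nonneg hT.le (hg0 _))
    _ = ∫ t, g t := by
        rw [integral_const_mul, Measure.integral_comp_mul_left]
        rw [smul_eq_mul, inv_neg, abs_neg, abs_of_pos (inv_pos.2 hT), ← mul_assoc,
          mul_inv_cancel₀ hT.ne', one_mul]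

/-- Since `D` decreases at most at unit rate, it stays above `β = D x - 2 a / T` on `[x, x + 2 a /
T]`. The kernel centred at `x + a / T` puts at least three quarters of its mass there, and elsewhere
`D ≥ -δ`; hence `β * (3 / 4) ≤ δ / 4 + η / c` when `β ≥ 0`. -/
theorem le_of_forall_integral_fejerKernel_mul_le {D : ℝ → ℝ} (hD : Measurable D) {δ η a T : ℝ}
    (hδ : ∀ x, |D x| ≤ δ) (hη : 0 ≤ η) (hT : 0 < T)
    (ha' : ∫ s in (Set.Icc (-a) a)ᶜ, fejerKernel s ≤ (∫ s, fejerKernel s) / 4)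
    (hmono : ∀ x s, 0 ≤ s → D x - s ≤ D (x + s))
    (hint : ∀ x, ∫ s, fejerKernel s * D (x - s / T) ≤ η) (x : ℝ) :
    D x ≤ δ / 3 + 4 / 3 * (η / ∫ s, fejerKernel s) + 2 * a / T := by
  set c := ∫ s, fejerKernel s with hc
  have hc0 : 0 < c := integral_fejerKernel_pos
  set β := D x - 2 * a / T with hβ
  have hδ0 : 0 ≤ δ := (abs_nonneg _).trans (hδ 0)
  rcases lt_or_ge β 0 with hβ0 | hβ0
  · have : 0 ≤ 4 / 3 * (η / c) := by positivity
    linarith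
  set I := Set.Icc (-a) a with hI
  have hIm : MeasurableSet I := measurableSet_Icc
  have hlow : ∀ s, β * fejerKernel s - (β + δ) * Iᶜ.indicator fejerKernel s ≤
      fejerKernel s * D (x + a / T - s / T) := by
    intro s
    have hK := fejerKernel_nonneg s
    by_cases hs : s ∈ I
    · rw [Set.indicator_of_notMem (by simpa using hs)]
      have h1 := hmono x (a / T - s / T) (by
        rw [sub_nonneg]
        exact div_le_div_of_nonneg_right hs.2 hT.le)
      have h2 : a / T - s / T ≤ 2 * a / T := by
        rw [← sub_div]
        exact div_le_div_of_nonneg_right (by linarith [hs.1]) hT.le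
      have h3 : β ≤ D (x + a / T - s / T) := by
        rw [add_sub_assoc]
        linarith
      nlinarith
    · rw [Set.indicator_of_mem (by simpa using hs)]
      have := (abs_le.1 (hδ (x + a / T - s / T))).1
      nlinarith
  have hi1 : Integrable fun s => β * fejerKernel s - (β + δ) * Iᶜ.indicator fejerKernel s :=
    (integrable_fejerKernel.const_mul _).sub
      ((integrable_fejerKernel.indicator hIm.compl).const_mul _)
  have hi2 : Integrable fun s => fejerKernel s * D (x + a / T - s / T) :=
    integrable_fejerKernel.mul_bdd (c := δ)
      (hD.comp (by fun_prop : Measurable fun s : ℝ => x + a / T - s / T)).aestronglyMeasurable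
      (ae_of_all _ fun s => hδ _)
  have h1 := (integral_mono hi1 hi2 hlow).trans (hint (x + a / T))
  rw [integral_sub (integrable_fejerKernel.const_mul _)
    ((integrable_fejerKernel.indicator hIm.compl).const_mul _), integral_const_mul,
    integral_const_mul, integral_indicator hIm.compl, ← hc] at h1
  have h2 : β * (3 / 4) ≤ δ / 4 + η / c := by
    rw [← sub_le_iff_le_add', le_div_iff₀ hc0]
    nlinarith
  linarith

/-- The one-sided estimate is applied to the difference `D` of the distribution functions and to its
reflection, with `δ` the supremum of `|D|`. The term `δ / 3` is then absorbed, giving `δ ≤ 2 η / c +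
3 a / T`. The condition `ν ≤ volume` makes the distribution function of `ν` Lipschitz with constant
`1`. -/
theorem exists_abs_measureReal_Iic_sub_le : ∃ C : ℝ, 0 < C ∧
    ∀ (μ ν : Measure ℝ) [IsProbabilityMeasure μ] [IsProbabilityMeasure ν],
      Integrable (fun y => y) μ → Integrable (fun y => y) ν → ν ≤ volume →
      ∀ (T : ℝ), 0 < T → ∀ g : ℝ → ℝ, Integrable g → (∀ t, 0 ≤ g t) →
      (∀ t, |t| ≤ T → ‖charFun μ t - charFun ν t‖ ≤ |t| * g t) →
      ∀ x, |μ.real (Set.Iic x) - ν.real (Set.Iic x)| ≤ C * ((∫ t, g t) + 1 / T) := by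
  obtain ⟨a, ha, ha'⟩ := exists_integral_fejerKernel_compl_le
  set c := ∫ s, fejerKernel s with hc
  have hc0 : 0 < c := integral_fejerKernel_pos
  refine ⟨2 / c + 3 * a, by positivity, ?_⟩
  intro μ ν _ _ hμ hν hνvol T hT g hg hg0 hφ
  set η := ∫ t, g t with hη
  have hη0 : 0 ≤ η := integral_nonneg hg0
  set D : ℝ → ℝ := fun x => μ.real (Set.Iic x) - ν.real (Set.Iic x) with hDdef
  have hmeas : ∀ ρ : Measure ℝ, [IsProbabilityMeasure ρ] → Measurable fun y => ρ.real (Set.Iic y) :=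
    fun ρ _ => Monotone.measurable fun a b hab => measureReal_mono (Set.Iic_subset_Iic.2 hab)
  have hDm : Measurable D := (hmeas μ).sub (hmeas ν)
  have hD1 : ∀ x, |D x| ≤ 1 := fun x => abs_le.2
    ⟨by linarith [measureReal_nonneg (μ := μ) (s := Set.Iic x),
        measureReal_le_one (μ := ν) (s := Set.Iic x)],
      by linarith [measureReal_nonneg (μ := ν) (s := Set.Iic x),
        measureReal_le_one (μ := μ) (s := Set.Iic x)]⟩
  have hmono : ∀ x s, 0 ≤ s → D x - s ≤ D (x + s) := by
    intro x s hs
    have h1 : μ.real (Set.Iic x) ≤ μ.real (Set.Iic (x + s)) :=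
      measureReal_mono (Set.Iic_subset_Iic.2 (by linarith))
    have h2 : ν.real (Set.Iic (x + s)) = ν.real (Set.Iic x) + ν.real (Set.Ioc x (x + s)) := by
      rw [← measureReal_union (Set.Iic_disjoint_Ioc le_rfl) measurableSet_Ioc,
        Set.Iic_union_Ioc_eq_Iic (by linarith)]
    have h3 : ν.real (Set.Ioc x (x + s)) ≤ s := by
      refine (ENNReal.toReal_mono (by simp) (hνvol _)).trans ?_
      simp [hs]
    simp only [hDdef]
    linarith
  have hbd : ∀ x, |∫ s, fejerKernel s * D (x - s / T)| ≤ η :=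
    abs_integral_fejerKernel_mul_sub_le μ ν hμ hν hT hg hφ hg0
  have hbdd : BddAbove (Set.range fun x => |D x|) := ⟨1, by rintro _ ⟨x, rfl⟩; exact hD1 x⟩
  set δ := ⨆ x, |D x| with hδ
  have hDδ : ∀ x, |D x| ≤ δ := fun x => le_ciSup hbdd x
  have hkey : ∀ x, |D x| ≤ δ / 3 + 4 / 3 * (η / c) + 2 * a / T := by
    intro x
    refine abs_le'.2 ⟨le_of_forall_integral_fejerKernel_mul_le hDm hDδ hη0 hT ha' hmono
      (fun x => (le_abs_self _).trans (hbd x)) x, ?_⟩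
    have := le_of_forall_integral_fejerKernel_mul_le (D := fun y => -D (-y))
      (hDm.comp measurable_neg).neg (fun x => by simpa using hDδ (-x)) hη0 hT ha'
      (fun y s hs => by
        have := hmono (-y - s) s hs
        rw [sub_add_cancel] at this
        rw [neg_add, ← sub_eq_add_neg]
        linarith) (fun y => ?_) (-x)
    · simpa using this
    · have h1 : ∫ s, fejerKernel s * -D (-(y - s / T)) =
          -∫ s, fejerKernel s * D (-y - s / T) := by
        rw [← integral_neg, ← integral_neg_eq_self]
        refine integral_congr_ae (ae_of_all _ fun s => ?_)
        simp only [fejerKernel_neg]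
        rw [mul_neg]
        congr 4
        ring
      rw [h1]
      exact (neg_le_abs _).trans (hbd _)
  have hδle : δ ≤ δ / 3 + 4 / 3 * (η / c) + 2 * a / T := ciSup_le hkey
  intro x
  refine (hDδ x).trans ?_
  have h2 : δ ≤ 2 / c * η + 3 * a * (1 / T) := by
    have e1 : 2 / c * η = 2 * (η / c) := by ring
    have e2 : 3 * a * (1 / T) = 3 / 2 * (2 * a / T) := by ring
    rw [e1, e2]
    linarith
  refine h2.trans ?_
  have h3 : 0 ≤ 2 / c * (1 / T) := by positivity
  have h4 : 0 ≤ 3 * a * η := by positivity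
  nlinarith

/-! ### Gaussian tails -/

theorem gaussianReal_le_volume (m : ℝ) {v : NNReal} (hv : 1 / 2 ≤ (v : ℝ)) :
    gaussianReal m v ≤ volume := by
  have hv0 : v ≠ 0 := by
    rintro rfl
    norm_num at hv
  rw [gaussianReal_of_var_ne_zero m hv0]
  conv_rhs => rw [← withDensity_one (μ := volume)]
  refine withDensity_mono (ae_of_all _ fun x => ?_)
  rw [gaussianPDF, Pi.one_apply, ← ENNReal.ofReal_one]
  refine ENNReal.ofReal_le_ofReal ?_
  rw [gaussianPDFReal_def]
  have h1 : 1 ≤ √(2 * Real.pi * v) := by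
    rw [Real.one_le_sqrt]
    nlinarith [Real.pi_gt_three]
  have h2 : Real.exp (-(x - m) ^ 2 / (2 * v)) ≤ 1 := by
    rw [Real.exp_le_one_iff]
    exact div_nonpos_of_nonpos_of_nonneg (by nlinarith [sq_nonneg (x - m)]) (by linarith)
  exact mul_le_one₀ (inv_le_one_of_one_le₀ h1) (Real.exp_pos _).le h2

theorem measureReal_gaussianReal (m : ℝ) {v : NNReal} (hv : v ≠ 0) (s : Set ℝ) :
    (gaussianReal m v).real s = ∫ x in s, gaussianPDFReal m v x := by
  rw [measureReal_def, gaussianReal_apply_eq_integral m hv, ENNReal.toReal_ofReal]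
  exact integral_nonneg fun x => gaussianPDFReal_nonneg m v x

theorem one_sub_stdNormalCDF (x : ℝ) :
    1 - stdNormalCDF x = (gaussianReal 0 1).real (Set.Ici x) := by
  rw [stdNormalCDF, cdf_eq_real, ← probReal_compl_eq_one_sub measurableSet_Iic, Set.compl_Iic]
  have : NullSingletonClass (gaussianReal 0 1) := nullSingletonClass_gaussianReal one_ne_zero
  exact measureReal_congr Ioi_ae_eq_Ici

theorem gaussianPDFReal_zero_one (x : ℝ) :
    gaussianPDFReal 0 1 x = (√(2 * Real.pi))⁻¹ * Real.exp (-x ^ 2 / 2) := by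
  simp [gaussianPDFReal_def]

/-- A lower bound for the Mills ratio. -/
theorem exists_le_measureReal_gaussianReal_Ici : ∃ c : ℝ, 0 < c ∧ ∀ x : ℝ, 0 ≤ x →
    c * Real.exp (-x ^ 2 / 2) ≤ (1 + x) * (gaussianReal 0 1).real (Set.Ici x) := by
  refine ⟨(√(2 * Real.pi))⁻¹ * Real.exp (-3 / 2), by positivity, fun x hx => ?_⟩
  -- On `[x, b]`, of length `1 / (1 + x)`, the density is at least a constant times `exp (-x ^ 2 /
  -- 2)`, because `y ^ 2 ≤ x ^ 2 + 3` there.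
  set b := x + 1 / (1 + x) with hb
  have hb2 : b ^ 2 ≤ x ^ 2 + 3 := by
    have h1 : x * (1 / (1 + x)) ≤ 1 := by
      rw [mul_one_div, div_le_one (by linarith)]
      linarith
    have h2 : (1 / (1 + x)) ^ 2 ≤ 1 := by
      refine pow_le_one₀ (by positivity) ?_
      rw [div_le_one (by linarith)]
      linarith
    rw [hb]
    nlinarith
  have h1 : (1 + x) * ∫ y in Set.Icc x b, gaussianPDFReal 0 1 y ≤
      (1 + x) * (gaussianReal 0 1).real (Set.Ici x) := by
    rw [← measureReal_gaussianReal 0 one_ne_zero]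
    refine mul_le_mul_of_nonneg_left (measureReal_mono fun y hy => hy.1) (by linarith)
  refine le_trans ?_ h1
  have h2 : ∫ _y in Set.Icc x b, (√(2 * Real.pi))⁻¹ * Real.exp (-(x ^ 2 + 3) / 2) ≤
      ∫ y in Set.Icc x b, gaussianPDFReal 0 1 y := by
    refine setIntegral_mono_on (integrableOn_const (by simp))
      (integrable_gaussianPDFReal 0 1).integrableOn
      measurableSet_Icc fun y hy => ?_
    rw [gaussianPDFReal_zero_one]
    have : y ^ 2 ≤ b ^ 2 := pow_le_pow_left₀ (hx.trans hy.1) hy.2 2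
    gcongr
    linarith
  refine le_trans (le_of_eq ?_) (mul_le_mul_of_nonneg_left h2 (by linarith))
  have hxb : x ≤ b := le_add_of_nonneg_right (by positivity)
  rw [setIntegral_const, Real.volume_real_Icc_of_le hxb,
    smul_eq_mul, mul_assoc, ← Real.exp_add]
  have h3 : b - x = 1 / (1 + x) := by rw [hb]; ring
  have h4 : (1 + x) * (1 / (1 + x)) = 1 := mul_one_div_cancel (by linarith)
  rw [h3, ← mul_assoc, h4, one_mul]
  congr 2
  ring

theorem measureReal_gaussianReal_Ici_sub_le {x a : ℝ} (hx : 0 ≤ x) (hxa : x ≤ a) :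
    (gaussianReal 0 1).real (Set.Ici x) - (gaussianReal 0 1).real (Set.Ici a) ≤
      (a - x) * Real.exp (-x ^ 2 / 2) := by
  have h1 : (gaussianReal 0 1).real (Set.Ici x) =
      (gaussianReal 0 1).real (Set.Ico x a) + (gaussianReal 0 1).real (Set.Ici a) := by
    rw [← measureReal_union _ measurableSet_Ici, Set.Ico_union_Ici_eq_Ici hxa]
    exact Set.disjoint_left.2 fun y hy hy' => absurd hy.2 (not_lt.2 hy')
  have h2 : ∫ y in Set.Ico x a, gaussianPDFReal 0 1 y ≤
      ∫ _y in Set.Ico x a, Real.exp (-x ^ 2 / 2) := by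
    refine setIntegral_mono_on (integrable_gaussianPDFReal 0 1).integrableOn (by simp)
      measurableSet_Ico fun y hy => ?_
    rw [gaussianPDFReal_zero_one]
    have h3 : x ^ 2 ≤ y ^ 2 := pow_le_pow_left₀ hx hy.1 2
    have h4 : 1 ≤ √(2 * Real.pi) := by
      rw [Real.one_le_sqrt]
      linarith [Real.pi_gt_three]
    refine (mul_le_of_le_one_left (Real.exp_pos _).le (inv_le_one_of_one_le₀ h4)).trans ?_
    gcongr
  rw [setIntegral_const, Real.volume_real_Ico_of_le hxa, smul_eq_mul,
    ← measureReal_gaussianReal 0 one_ne_zero] at h2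
  linarith

theorem measureReal_gaussianReal_Ici_eq (m : ℝ) {v : NNReal} (hv : v ≠ 0) (x : ℝ) :
    (gaussianReal m v).real (Set.Ici x) =
      (gaussianReal 0 1).real (Set.Ici ((x - m) / √(v : ℝ))) := by
  have hv' : 0 < (v : ℝ) := by positivity
  have h1 : gaussianReal m v = (gaussianReal 0 1).map (fun y => √(v : ℝ) * y + m) := by
    have : (fun y : ℝ => √(v : ℝ) * y + m) = (fun y => y + m) ∘ (fun y => √(v : ℝ) * y) := rfl
    rw [this, ← Measure.map_map (by fun_prop) (by fun_prop), gaussianReal_map_const_mul,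
      gaussianReal_map_add_const]
    congr 1
    · simp
    · apply NNReal.eq
      simp [Real.sq_sqrt hv'.le]
  rw [h1, map_measureReal_apply (by fun_prop) measurableSet_Ici]
  congr 1
  ext y
  simp only [Set.mem_preimage, Set.mem_Ici]
  rw [div_le_iff₀ (Real.sqrt_pos.2 hv'), sub_le_iff_le_add, mul_comm]

theorem setIntegral_exp_gaussianReal (m h : ℝ) {v : NNReal} (hv : v ≠ 0) {s : Set ℝ}
    (hs : MeasurableSet s) :
    ∫ y in s, Real.exp (-(h * y)) ∂gaussianReal m v =
      Real.exp (-(h * m) + h ^ 2 * v / 2) * (gaussianReal (m - h * v) v).real s := by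
  have hv' : (v : ℝ) ≠ 0 := by exact_mod_cast hv
  rw [measureReal_gaussianReal _ hv, gaussianReal_of_var_ne_zero m hv,
    setIntegral_withDensity_eq_setIntegral_toReal_smul (measurable_gaussianPDF m v)
      (ae_of_all _ fun x => by simp [gaussianPDF]) _ hs, ← integral_const_mul]
  refine integral_congr_ae (ae_of_all _ fun y => ?_)
  simp only [toReal_gaussianPDF, gaussianPDFReal_def, smul_eq_mul]
  rw [mul_assoc, ← Real.exp_add, mul_left_comm, ← Real.exp_add]
  congr 2
  field_simp
  ring

/-! ### Exponential tail integrals and the Kolmogorov distance -/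

theorem abs_measureReal_Iio_sub_le {μ ν : Measure ℝ} [IsProbabilityMeasure μ]
    [IsProbabilityMeasure ν] {δ : ℝ}
    (h : ∀ x, |μ.real (Set.Iic x) - ν.real (Set.Iic x)| ≤ δ) (x : ℝ) :
    |μ.real (Set.Iio x) - ν.real (Set.Iio x)| ≤ δ := by
  obtain ⟨u, hu, hux, hlim⟩ := exists_seq_strictMono_tendsto x
  have hl : ∀ ρ : Measure ℝ, [IsProbabilityMeasure ρ] →
      Tendsto (fun n => ρ.real (Set.Iic (u n))) atTop (𝓝 (ρ.real (Set.Iio x))) := by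
    intro ρ _
    have h1 := tendsto_measure_iUnion_atTop (μ := ρ) (s := fun n => Set.Iic (u n))
      fun a b hab => Set.Iic_subset_Iic.2 (hu.monotone hab)
    rw [iUnion_Iic_eq_Iio_of_lt_of_tendsto hux hlim] at h1
    exact (ENNReal.tendsto_toReal (measure_ne_top _ _)).comp h1
  exact le_of_tendsto ((hl μ).sub (hl ν)).abs (Eventually.of_forall fun n => h _)

/-- Layer-cake formula: the superlevel sets of `exp (-h y)` restricted to `[x, ∞)` are intervals, on
which the two laws differ by at most `2 δ`, and only levels up to `exp (-h x)` occur. -/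
theorem abs_setIntegral_exp_sub_le {μ ν : Measure ℝ} [IsProbabilityMeasure μ]
    [IsProbabilityMeasure ν] {δ : ℝ}
    (hδ : ∀ x, |μ.real (Set.Iic x) - ν.real (Set.Iic x)| ≤ δ) {h : ℝ} (hh : 0 ≤ h) (x : ℝ) :
    |∫ y in Set.Ici x, Real.exp (-(h * y)) ∂μ - ∫ y in Set.Ici x, Real.exp (-(h * y)) ∂ν| ≤
      2 * δ * Real.exp (-(h * x)) := by
  have hδ0 : 0 ≤ δ := (abs_nonneg _).trans (hδ 0)
  set M := Real.exp (-(h * x)) with hM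
  set f : ℝ → ℝ := (Set.Ici x).indicator fun y => Real.exp (-(h * y)) with hf
  have hf0 : ∀ y, 0 ≤ f y := fun y => Set.indicator_nonneg (fun _ _ => (Real.exp_pos _).le) y
  have hfM : ∀ y, f y ≤ M := by
    intro y
    rw [hf]
    by_cases hy : y ∈ Set.Ici x
    · rw [Set.indicator_of_mem hy, hM]
      have : h * x ≤ h * y := mul_le_mul_of_nonneg_left hy hh
      gcongr
    · rw [Set.indicator_of_notMem hy]
      positivity
  have hfm : Measurable f := Measurable.indicator (by fun_prop) measurableSet_Ici
  have hIio := abs_measureReal_Iio_sub_le hδ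
  have hIci : ∀ y, |μ.real (Set.Ici y) - ν.real (Set.Ici y)| ≤ δ := by
    intro y
    rw [← Set.compl_Iio, probReal_compl_eq_one_sub measurableSet_Iio,
      probReal_compl_eq_one_sub measurableSet_Iio, abs_sub_comm]
    convert hIio y using 2
    ring
  have hset : ∀ t, 0 < t → |μ.real {y | t < f y} - ν.real {y | t < f y}| ≤ 2 * δ := by
    intro t ht
    have hmem : ∀ y, t < f y ↔ x ≤ y ∧ h * y < -Real.log t := by
      intro y
      by_cases hy : y ∈ Set.Ici x
      · rw [hf, Set.indicator_of_mem hy, ← Real.log_lt_iff_lt_exp ht]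
        exact ⟨fun H => ⟨hy, by linarith⟩, fun H => by linarith [H.2]⟩
      · rw [hf, Set.indicator_of_notMem hy]
        exact ⟨fun H => absurd H (not_lt.2 ht.le), fun H => absurd H.1 hy⟩
    simp_rw [hmem]
    rcases hh.eq_or_lt with rfl | hh'
    · by_cases hl : 0 < -Real.log t
      · simp only [zero_mul, hl, and_true]
        exact (hIci x).trans (by linarith)
      · simp only [zero_mul, hl, and_false, Set.ofPred_false, measureReal_empty, sub_zero, abs_zero]
        linarith
    · have : {y | x ≤ y ∧ h * y < -Real.log t} = Set.Ico x (-Real.log t / h) := by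
        ext y
        simp only [Set.mem_ofPred_eq, Set.mem_Ico, lt_div_iff₀ hh', mul_comm y h]
      rw [this]
      set b := -Real.log t / h
      rcases le_total x b with hxb | hxb
      · have hIco : ∀ ρ : Measure ℝ, [IsProbabilityMeasure ρ] →
            ρ.real (Set.Ico x b) = ρ.real (Set.Iio b) - ρ.real (Set.Iio x) := by
          intro ρ _
          rw [← Set.Iio_union_Ico_eq_Iio hxb, measureReal_union _ measurableSet_Ico]
          · ring
          · exact Set.disjoint_left.2 fun y hy hy' => absurd hy (not_lt.2 hy'.1)
        rw [hIco μ, hIco ν]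
        have h1 := abs_le.1 (hIio b)
        have h2 := abs_le.1 (hIio x)
        exact abs_le.2 ⟨by linarith [h1.1, h2.2], by linarith [h1.2, h2.1]⟩
      · rw [Set.Ico_eq_empty (not_lt.2 hxb)]
        simp only [measureReal_empty, sub_zero, abs_zero]
        linarith
  have hlayer : ∀ ρ : Measure ℝ, [IsProbabilityMeasure ρ] →
      ∫ y in Set.Ici x, Real.exp (-(h * y)) ∂ρ = ∫ t in Set.Ioc 0 M, ρ.real {y | t < f y} := by
    intro ρ _
    rw [← integral_indicator measurableSet_Ici, Integrable.integral_eq_integral_meas_lt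
      (Integrable.of_bound (C := M) hfm.aestronglyMeasurable (ae_of_all _ fun y => by
        rw [Real.norm_of_nonneg (hf0 y)]
        exact hfM y)) (ae_of_all _ hf0)]
    refine setIntegral_eq_of_subset_of_forall_sdiff_eq_zero measurableSet_Ioi
      (fun t ht => ht.1) fun t ht => ?_
    have : M < t := by
      by_contra hcon
      exact ht.2 ⟨ht.1, not_lt.1 hcon⟩
    have he : {y | t < f y} = ∅ := Set.eq_empty_of_forall_notMem fun y hy =>
      absurd (hfM y) (not_le.2 (this.trans hy))
    rw [he, measureReal_empty]
  have hint : ∀ ρ : Measure ℝ, [IsProbabilityMeasure ρ] →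
      IntegrableOn (fun t => ρ.real {y | t < f y}) (Set.Ioc 0 M) := by
    intro ρ _
    have hanti : Antitone fun t => ρ.real {y | t < f y} :=
      fun s t hst => measureReal_mono fun y hy => lt_of_le_of_lt hst hy
    exact Integrable.of_bound (C := 1) hanti.measurable.aestronglyMeasurable
      (ae_of_all _ fun t => by
        rw [Real.norm_of_nonneg measureReal_nonneg]
        exact measureReal_le_one)
  rw [hlayer μ, hlayer ν, ← integral_sub (hint μ) (hint ν), ← Real.norm_eq_abs]
  refine (norm_setIntegral_le_of_norm_le_const (C := 2 * δ) (by simp)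
    fun t ht => hset t ht.1).trans (le_of_eq ?_)
  rw [Real.volume_real_Ioc_of_le (Real.exp_pos _).le, sub_zero]

/-! ### Exponential tilting and large deviations in the cubic zone -/

/-- The function `k` is a logarithm of the moment generating function of `μ` on the disc of radius
`T / 2`, and differs there from `z ^ 2 / 2 + lam * z ^ 3 / 6` by a remainder which is of fourth
order in `z` and of second order in `T⁻¹`. -/
structure HasCubicExpansion (μ : Measure ℝ) (k : ℂ → ℂ) (T lam A : ℝ) : Prop where
  integrable : ∀ h : ℝ, |h| < T / 2 → Integrable (fun y : ℝ => Real.exp (h * y)) μ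
  complexMGF_eq : ∀ z : ℂ, ‖z‖ < T / 2 → complexMGF id μ z = Complex.exp (k z)
  map_zero : k 0 = 0
  abs_lam_le : |lam| ≤ A / T
  remainder_le : ∀ r < T / 2, ∀ z w : ℂ, ‖z‖ ≤ r → ‖w‖ ≤ r →
    ‖(k z - (z ^ 2 / 2 + lam * z ^ 3 / 6)) - (k w - (w ^ 2 / 2 + lam * w ^ 3 / 6))‖ ≤
      A * r ^ 3 / T ^ 2 * ‖z - w‖

namespace HasCubicExpansion

variable {μ : Measure ℝ} {k : ℂ → ℂ} {T lam A : ℝ}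

theorem mgf_eq (H : HasCubicExpansion μ k T lam A) {x : ℝ} (hx : |x| < T / 2) :
    mgf id μ x = Real.exp (k x).re := by
  have h := H.complexMGF_eq x (by simpa using hx)
  rw [complexMGF_ofReal] at h
  rw [← Complex.norm_exp, ← h, Complex.norm_real, Real.norm_of_nonneg mgf_nonneg]

theorem charFun_tilted (H : HasCubicExpansion μ k T lam A) {x t : ℝ}
    (hxt : |x| + |t| < T / 2) :
    charFun (μ.tilted fun y => x * id y) t = Complex.exp (k (x + t * Complex.I) - k x) := by
  have hx : |x| < T / 2 := by linarith [abs_nonneg t]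
  have h1 := H.complexMGF_eq x (by simpa using hx)
  have h2 := H.complexMGF_eq (x + t * Complex.I) (by
    refine (norm_add_le _ _).trans_lt ?_
    simpa using hxt)
  rw [complexMGF_ofReal] at h1
  rw [charFun_apply_real, integral_tilted_mul_eq_mgf, Complex.exp_sub, ← h1, ← h2, complexMGF,
    ← integral_div]
  refine integral_congr_ae (ae_of_all _ fun y => ?_)
  simp only [id, Complex.real_smul, Complex.ofReal_div, Complex.ofReal_exp]
  rw [div_mul_eq_mul_div, ← Complex.exp_add]
  congr 2
  push_cast
  ring

theorem isProbabilityMeasure_tilted [IsProbabilityMeasure μ] (H : HasCubicExpansion μ k T lam A)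
    {x : ℝ} (hx : |x| < T / 2) : IsProbabilityMeasure (μ.tilted fun y => x * id y) :=
  MeasureTheory.isProbabilityMeasure_tilted (H.integrable x hx)

theorem integrable_id_tilted (H : HasCubicExpansion μ k T lam A) {x : ℝ} (hx : |x| < T / 2) :
    Integrable (fun y => y) (μ.tilted fun y => x * id y) := by
  have h : x ∈ interior (integrableExpSet id μ) := by
    rw [mem_interior_iff_mem_nhds]
    filter_upwards [continuous_abs.continuousAt.eventually_lt_const hx] with s hs
    exact H.integrable s hs
  have h1 : MemLp id 1 (μ.tilted fun y => x * id y) := by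
    simpa only [ENNReal.coe_one] using memLp_tilted_mul h 1
  exact memLp_one_iff_integrable.1 h1

/-- The Gaussian absorbs the linear and quadratic terms in `t` of the expansion of the exponent
about `x`. Without the variance correction `lam x` the distance would be of order `x / T`, too large
after division by the normal tail. What remains is `ρ = O((|t| + |t| ^ 3) / T)`; in `D`, the `5 A`
collects the cubic term and the `|t| ^ 3` part of the remainder, and `4 A K` comes from `x ^ 3 ≤ K
T`. -/
theorem norm_charFun_tilted_sub_le (H : HasCubicExpansion μ k T lam A) {K D κ x t : ℝ}
    (hA : 0 ≤ A) (hT : 1 ≤ T) (hx0 : 0 ≤ x) (hx : x ≤ T / 8) (hxK : x ^ 3 ≤ K * T)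
    (hlx : |lam * x| ≤ 1 / 2) (hD : 5 * A + 4 * A * K ≤ D) (hK : 0 ≤ K)
    (hκ : κ ≤ 1 / 8) (hκD : D * κ ≤ 1 / 8) (ht : |t| ≤ κ * T)
    {v : NNReal} (hv : (v : ℝ) = 1 + lam * x) :
    ‖charFun (μ.tilted fun y => x * id y) t -
      charFun (gaussianReal (x + lam * x ^ 2 / 2) v) t‖ ≤
      |t| * (32 * D / T * Real.exp (-(1 / 16) * t ^ 2)) := by
  have hT0 : 0 < T := by linarith
  have hAK : 0 ≤ A * K := mul_nonneg hA hK
  have hD0 : 0 ≤ D := by linarith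
  have htT : |t| ≤ T / 8 := ht.trans (by nlinarith)
  have hxt : |x| + |t| < T / 2 := by
    rw [abs_of_nonneg hx0]
    linarith
  have hxt' : x + |t| < T / 2 := by rwa [abs_of_nonneg hx0] at hxt
  set q : ℂ → ℂ := fun z => k z - (z ^ 2 / 2 + lam * z ^ 3 / 6) with hq
  set ρ : ℂ := -(lam * t ^ 3 / 6 * Complex.I) + (q (x + t * Complex.I) - q x) with hρ
  have hsplit : k (x + t * Complex.I) - k x =
      ((t * (x + lam * x ^ 2 / 2 : ℝ) * Complex.I - v * t ^ 2 / 2 : ℂ)) + ρ := by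
    have hv' : ((v : ℝ) : ℂ) = 1 + lam * x := by rw [hv]; push_cast; ring
    have hI3 : Complex.I ^ 3 = -Complex.I := Complex.I_pow_three
    rw [hρ, hq, hv']
    push_cast
    ring_nf
    rw [hI3, Complex.I_sq]
    ring
  have hτ0 := abs_nonneg t
  have hqle : ‖q (x + t * Complex.I) - q x‖ ≤ A * (x + |t|) ^ 3 / T ^ 2 * |t| := by
    have := H.remainder_le (x + |t|) hxt' (x + t * Complex.I) x
      ((norm_add_le _ _).trans (by simp [abs_of_nonneg hx0]))
      (by simp [abs_of_nonneg hx0])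
    simpa using this
  have hρle : ‖ρ‖ ≤ D * (|t| + |t| ^ 3) / T := by
    have h1 : ‖-(lam * t ^ 3 / 6 * Complex.I : ℂ)‖ ≤ A * |t| ^ 3 / T := by
      rw [norm_neg, norm_mul, Complex.norm_I, mul_one, norm_div, norm_mul, norm_pow,
        Complex.norm_real, Complex.norm_real, Real.norm_eq_abs, Real.norm_eq_abs]
      have h6 : ‖(6 : ℂ)‖ = 6 := by simp
      rw [h6]
      calc |lam| * |t| ^ 3 / 6 ≤ |lam| * |t| ^ 3 := div_le_self (by positivity) (by norm_num)
        _ ≤ A / T * |t| ^ 3 := by gcongr; exact H.abs_lam_le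
        _ = A * |t| ^ 3 / T := by ring
    have h2 : A * (x + |t|) ^ 3 / T ^ 2 * |t| ≤ 4 * A * K * |t| / T + 4 * A * |t| ^ 3 / T := by
      have h3 : (x + |t|) ^ 3 ≤ 4 * (x ^ 3 + |t| ^ 3) := by
        nlinarith [mul_nonneg (add_nonneg hx0 hτ0) (sq_nonneg (x - |t|))]
      have h4 : |t| ^ 3 * |t| ≤ |t| ^ 3 * T := by
        gcongr
        linarith
      rw [div_mul_eq_mul_div, ← add_div, div_le_div_iff₀ (by positivity) hT0]
      have h5 : (x + |t|) ^ 3 * |t| ≤ 4 * (K * T * |t| + |t| ^ 3 * T) := by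
        calc (x + |t|) ^ 3 * |t| ≤ 4 * (x ^ 3 + |t| ^ 3) * |t| := by gcongr
          _ = 4 * (x ^ 3 * |t| + |t| ^ 3 * |t|) := by ring
          _ ≤ 4 * (K * T * |t| + |t| ^ 3 * T) := by gcongr
      calc A * (x + |t|) ^ 3 * |t| * T = A * T * ((x + |t|) ^ 3 * |t|) := by ring
        _ ≤ A * T * (4 * (K * T * |t| + |t| ^ 3 * T)) := by gcongr
        _ = (4 * A * K * |t| + 4 * A * |t| ^ 3) * T ^ 2 := by ring
    have h7 : A * |t| ^ 3 / T + (4 * A * K * |t| / T + 4 * A * |t| ^ 3 / T) ≤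
        D * (|t| + |t| ^ 3) / T := by
      rw [← add_div, ← add_div]
      gcongr
      have h8 : 4 * (A * K) * |t| ≤ D * |t| := by
        gcongr
        linarith
      have h9 : 5 * A * |t| ^ 3 ≤ D * |t| ^ 3 := by
        gcongr
        linarith
      linarith
    exact (norm_add_le _ _).trans ((add_le_add h1 (hqle.trans h2)).trans h7)
  -- The restriction `|t| ≤ κ T` keeps `exp ‖ρ‖` below the Gaussian decay `exp (-t ^ 2 / 4)`.
  have hρexp : ‖ρ‖ ≤ 1 / 8 + t ^ 2 / 8 := by
    refine hρle.trans ?_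
    have h1 : D * |t| ≤ T / 8 := by
      calc D * |t| ≤ D * (κ * T) := by gcongr
        _ = D * κ * T := by ring
        _ ≤ 1 / 8 * T := by gcongr
        _ = T / 8 := by ring
    rw [div_le_iff₀ hT0, ← sq_abs t]
    have : D * (|t| + |t| ^ 3) = D * |t| * (1 + |t| ^ 2) := by ring
    rw [this]
    calc D * |t| * (1 + |t| ^ 2) ≤ T / 8 * (1 + |t| ^ 2) := by gcongr
      _ = (1 / 8 + |t| ^ 2 / 8) * T := by ring
  have hexp : ‖Complex.exp ρ - 1‖ ≤ ‖ρ‖ * Real.exp ‖ρ‖ := by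
    simpa using Complex.norm_exp_sub_sum_le_norm_mul_exp ρ 1
  rw [H.charFun_tilted hxt, charFun_gaussianReal, hsplit, Complex.exp_add, ← mul_sub_one, norm_mul,
    Complex.norm_exp]
  have hre : (t * (x + lam * x ^ 2 / 2 : ℝ) * Complex.I - v * t ^ 2 / 2 : ℂ).re =
      -(v * t ^ 2 / 2) := by
    have : (t * (x + lam * x ^ 2 / 2 : ℝ) * Complex.I - v * t ^ 2 / 2 : ℂ) =
        ((t * (x + lam * x ^ 2 / 2) : ℝ) : ℂ) * Complex.I + ((-(v * t ^ 2 / 2) : ℝ) : ℂ) := by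
      push_cast
      ring
    rw [this, Complex.add_re, Complex.re_ofReal_mul, Complex.I_re, mul_zero, zero_add,
      Complex.ofReal_re]
  rw [hre]
  have hvhalf : 1 / 2 ≤ (v : ℝ) := by
    rw [hv]
    linarith [(abs_le.1 hlx).1]
  calc Real.exp (-(v * t ^ 2 / 2)) * ‖Complex.exp ρ - 1‖
      ≤ Real.exp (-(1 / 4) * t ^ 2) * (D * (|t| + |t| ^ 3) / T *
          Real.exp (1 / 8 + t ^ 2 / 8)) := by
        refine mul_le_mul ?_ (hexp.trans ?_) (norm_nonneg _) (Real.exp_pos _).le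
        · gcongr
          nlinarith [sq_nonneg t]
        · gcongr
    _ = |t| * (D / T * ((1 + t ^ 2) * Real.exp (1 / 8 + -(1 / 8) * t ^ 2))) := by
        have : (1 / 8 + -(1 / 8) * t ^ 2 : ℝ) = -(1 / 4) * t ^ 2 + (1 / 8 + t ^ 2 / 8) := by ring
        rw [this, Real.exp_add (-(1 / 4) * t ^ 2), ← sq_abs t]
        ring
    _ ≤ |t| * (D / T * (32 * Real.exp (-(1 / 16) * t ^ 2))) := by
        have h1 : (1 + t ^ 2) ≤ 16 * Real.exp (t ^ 2 / 16) := by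
          nlinarith [Real.add_one_le_exp (t ^ 2 / 16)]
        have h2 : Real.exp (1 / 8) ≤ 2 := by
          have h3 : Real.exp (1 / 8) ≤ Real.exp (Real.log 2) := by
            gcongr
            linarith [Real.log_two_gt_d9]
          rwa [Real.exp_log two_pos] at h3
        refine mul_le_mul_of_nonneg_left (mul_le_mul_of_nonneg_left ?_ (by positivity)) hτ0
        calc (1 + t ^ 2) * Real.exp (1 / 8 + -(1 / 8) * t ^ 2)
            ≤ (16 * Real.exp (t ^ 2 / 16)) * (2 * Real.exp (-(1 / 8) * t ^ 2)) := by
              rw [Real.exp_add]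
              gcongr
          _ = 32 * (Real.exp (t ^ 2 / 16) * Real.exp (-(1 / 8) * t ^ 2)) := by ring
          _ = 32 * Real.exp (-(1 / 16) * t ^ 2) := by
              rw [← Real.exp_add]
              congr 2
              ring
    _ = |t| * (32 * D / T * Real.exp (-(1 / 16) * t ^ 2)) := by ring

end HasCubicExpansion

theorem exists_abs_measureReal_tilted_sub_le {A K : ℝ} (hA : 0 ≤ A) (hK : 0 ≤ K) :
    ∃ C : ℝ, 0 ≤ C ∧ ∀ (μ : Measure ℝ) [IsProbabilityMeasure μ] (k : ℂ → ℂ) (T lam x : ℝ)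
      (v : NNReal), HasCubicExpansion μ k T lam A → 1 ≤ T → 0 ≤ x → x ≤ T / 8 → x ^ 3 ≤ K * T →
      |lam * x| ≤ 1 / 2 → (v : ℝ) = 1 + lam * x → ∀ y,
      |(μ.tilted fun y => x * id y).real (Set.Iic y) -
        (gaussianReal (x + lam * x ^ 2 / 2) v).real (Set.Iic y)| ≤ C / T := by
  obtain ⟨C₀, hC₀, hBE⟩ := exists_abs_measureReal_Iic_sub_le
  set D : ℝ := 5 * A + 4 * A * K + 1 with hD
  have hAK : 0 ≤ A * K := mul_nonneg hA hK
  have hD1 : 1 ≤ D := by linarith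
  -- Smoothing at the level `κ T` costs `1 / (κ T)`, still `O(1 / T)`; the `+ 1` in `D` ensures `κ ≤
  -- 1 / 8`.
  set κ : ℝ := 1 / (8 * D) with hκ
  have hκ0 : 0 < κ := by positivity
  set J : ℝ := ∫ t : ℝ, Real.exp (-(1 / 16) * t ^ 2) with hJ
  have hJ0 : 0 ≤ J := integral_nonneg fun t => (Real.exp_pos _).le
  refine ⟨C₀ * (32 * D * J + 1 / κ), by positivity, ?_⟩
  intro μ _ k T lam x v H hT hx0 hx hxK hlx hv y
  have hT0 : 0 < T := by linarith
  have hxT : |x| < T / 2 := by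
    rw [abs_of_nonneg hx0]
    linarith
  have := H.isProbabilityMeasure_tilted hxT
  have hvhalf : 1 / 2 ≤ (v : ℝ) := by
    rw [hv]
    linarith [(abs_le.1 hlx).1]
  have hgauss : Integrable (fun y => y) (gaussianReal (x + lam * x ^ 2 / 2) v) := by
    have h1 : MemLp id 1 (gaussianReal (x + lam * x ^ 2 / 2) v) := by
      simpa only [ENNReal.coe_one] using memLp_id_gaussianReal 1
    exact memLp_one_iff_integrable.1 h1
  have hκ8 : κ ≤ 1 / 8 := by
    rw [hκ]
    exact one_div_le_one_div_of_le (by norm_num) (by linarith)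
  have hDκ : D * κ ≤ 1 / 8 := by
    rw [hκ]
    field_simp
    norm_num
  have h := hBE (μ.tilted fun y => x * id y) (gaussianReal (x + lam * x ^ 2 / 2) v)
    (H.integrable_id_tilted hxT) hgauss (gaussianReal_le_volume _ hvhalf) (κ * T) (by positivity)
    (fun t => 32 * D / T * Real.exp (-(1 / 16) * t ^ 2))
    ((integrable_exp_neg_mul_sq (by norm_num)).const_mul _) (fun t => by positivity)
    (fun t ht => H.norm_charFun_tilted_sub_le hA hT hx0 hx hxK hlx (by linarith) hK hκ8 hDκ ht hv) y
  refine h.trans (le_of_eq ?_)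
  rw [integral_const_mul, ← hJ]
  field_simp

/-- With `u = lam x` the quotient is the standardized endpoint of the Gaussian tail. The first-order
terms in `u` cancel, which is what makes the shift negligible. -/
theorem le_div_sqrt_one_add {x u : ℝ} (hx : 0 ≤ x) (hu : |u| ≤ 1 / 2) :
    x ≤ x * (1 + u / 2) / √(1 + u) ∧ x * (1 + u / 2) / √(1 + u) - x ≤ x * u ^ 2 := by
  obtain ⟨hu1, hu2⟩ := abs_le.1 hu
  have hs : 0 < √(1 + u) := Real.sqrt_pos.2 (by linarith)
  have hsq : √(1 + u) ^ 2 = 1 + u := Real.sq_sqrt (by linarith)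
  constructor
  · rw [le_div_iff₀ hs]
    have : √(1 + u) ≤ 1 + u / 2 := by
      refine Real.sqrt_le_iff.2 ⟨by linarith, ?_⟩
      nlinarith [sq_nonneg u]
    gcongr
  · rw [sub_le_iff_le_add, div_le_iff₀ hs]
    have : 1 + u / 2 ≤ (1 + u ^ 2) * √(1 + u) := by
      refine le_of_sq_le_sq ?_ (by positivity)
      rw [mul_pow, hsq]
      have h1 : 1 + 2 * u ^ 2 ≤ (1 + u ^ 2) ^ 2 := by nlinarith [sq_nonneg (u ^ 2)]
      have h2 : (1 + 2 * u ^ 2) * (1 + u) ≤ (1 + u ^ 2) ^ 2 * (1 + u) := by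
        gcongr
        linarith
      nlinarith [mul_nonneg (sq_nonneg u) (by linarith : 0 ≤ 1 + 2 * u)]
    calc x * (1 + u / 2) ≤ x * ((1 + u ^ 2) * √(1 + u)) := by gcongr
      _ = (x * u ^ 2 + x) * √(1 + u) := by ring

theorem HasCubicExpansion.measureReal_Ici_eq {μ : Measure ℝ} [IsProbabilityMeasure μ]
    {k : ℂ → ℂ} {T lam A x : ℝ} (H : HasCubicExpansion μ k T lam A) (hx : |x| < T / 2) :
    μ.real (Set.Ici x) = Real.exp (k x).re *
      ∫ y in Set.Ici x, Real.exp (-(x * y)) ∂(μ.tilted fun y => x * id y) := by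
  rw [setIntegral_tilted_mul_eq_mgf, H.mgf_eq hx]
  have : ∀ y : ℝ, (Real.exp (x * id y) / Real.exp (k x).re) • Real.exp (-(x * y)) =
      (Real.exp (k x).re)⁻¹ := by
    intro y
    rw [smul_eq_mul, div_mul_eq_mul_div, ← Real.exp_add]
    simp
  simp_rw [this]
  rw [setIntegral_const, smul_eq_mul]
  field_simp

/-- The large deviation relation in the cubic zone for a law with a cubic expansion of the
logarithm of the moment generating function. -/
theorem exists_measureReal_Ici_div_eq {A K : ℝ} (hA : 0 ≤ A) (hK : 0 ≤ K) :
    ∃ C T₀ : ℝ, 0 < T₀ ∧ ∀ (μ : Measure ℝ) [IsProbabilityMeasure μ] (k : ℂ → ℂ) (T lam x : ℝ),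
      HasCubicExpansion μ k T lam A → T₀ ≤ T → 0 ≤ x → x ^ 3 ≤ K * T →
      ∃ r : ℝ, |r| ≤ C * ((x + 1) / T) ∧
        μ.real (Set.Ici x) / (gaussianReal 0 1).real (Set.Ici x) =
          Real.exp (lam * x ^ 3 / 6) * (1 + r) := by
  obtain ⟨C₁, hC₁, hKol⟩ := exists_abs_measureReal_tilted_sub_le hA hK
  obtain ⟨c, hc, hMills⟩ := exists_le_measureReal_gaussianReal_Ici
  -- The inequality `N x ≤ T` yields both `x ≤ T / 8` and `A x ≤ T / 2`. It follows from `(N x) ^ 3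
  -- ≤ K N ^ 3 T ≤ T ^ 3` once `T ≥ 1 + K N ^ 3`.
  set N : ℝ := 8 + 2 * A with hN
  have hN8 : 8 ≤ N := by linarith
  set C₂ : ℝ := (A ^ 2 * K + 2 * C₁) / c with hC₂
  have hC₂0 : 0 ≤ C₂ := by positivity
  refine ⟨Real.exp (A * K) * (A * K + C₂), 1 + K * N ^ 3, by positivity, ?_⟩
  intro μ _ k T lam x H hT hx0 hxK
  have hKN : 0 ≤ K * N ^ 3 := by positivity
  have hT1 : 1 ≤ T := by linarith
  have hT0 : 0 < T := by linarith
  have hxN : N * x ≤ T := by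
    by_contra hcon
    have h1 : T ^ 3 < (N * x) ^ 3 := pow_lt_pow_left₀ (not_le.1 hcon) hT0.le (by norm_num)
    have h2 : (N * x) ^ 3 ≤ K * N ^ 3 * T := by
      calc (N * x) ^ 3 = N ^ 3 * x ^ 3 := by ring
        _ ≤ N ^ 3 * (K * T) := by gcongr
        _ = K * N ^ 3 * T := by ring
    have h3 : K * N ^ 3 * T ≤ T ^ 3 := by
      calc K * N ^ 3 * T ≤ T * T := by gcongr; linarith
        _ = T ^ 2 := by ring
        _ ≤ T ^ 3 := pow_le_pow_right₀ hT1 (by norm_num)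
    linarith
  have hx8 : x ≤ T / 8 := by nlinarith
  have hAx : A * x ≤ T / 2 := by nlinarith
  have hxT : |x| < T / 2 := by
    rw [abs_of_nonneg hx0]
    linarith
  have hlam : |lam * x| ≤ A * x / T := by
    rw [abs_mul, abs_of_nonneg hx0, mul_div_right_comm]
    exact mul_le_mul_of_nonneg_right H.abs_lam_le hx0
  have hlx : |lam * x| ≤ 1 / 2 := by
    refine hlam.trans ?_
    rw [div_le_iff₀ hT0]
    linarith
  have hv0 : 0 < 1 + lam * x := by linarith [(abs_le.1 hlx).1]
  set v : NNReal := ⟨1 + lam * x, hv0.le⟩ with hvdef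
  have hv : (v : ℝ) = 1 + lam * x := rfl
  have hvne : v ≠ 0 := by
    intro h
    rw [h] at hv
    simp only [NNReal.coe_zero] at hv
    linarith
  have hprob := H.isProbabilityMeasure_tilted hxT
  have hdiff := abs_setIntegral_exp_sub_le (hKol μ k T lam x v H hT1 hx0 hx8 hxK hlx hv) hx0 x
  rw [setIntegral_exp_gaussianReal _ _ hvne measurableSet_Ici,
    measureReal_gaussianReal_Ici_eq _ hvne] at hdiff
  -- The corrections to mean and variance cancel exactly in the exponent, so the cubic term arises
  -- only from `k x`.
  have hmain : -(x * (x + lam * x ^ 2 / 2)) + x ^ 2 * v / 2 = -x ^ 2 / 2 := by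
    rw [hv]
    ring
  have harg : (x - (x + lam * x ^ 2 / 2 - x * v)) / √(v : ℝ) =
      x * (1 + lam * x / 2) / √(1 + lam * x) := by
    rw [hv]
    congr 1
    ring
  rw [hmain, harg] at hdiff
  set a := x * (1 + lam * x / 2) / √(1 + lam * x) with ha
  obtain ⟨hxa, hax⟩ := le_div_sqrt_one_add hx0 hlx
  set Q := (gaussianReal 0 1).real (Set.Ici x) with hQ
  set Qa := (gaussianReal 0 1).real (Set.Ici a) with hQa
  set e := Real.exp (-x ^ 2 / 2) with he
  have he0 : 0 < e := Real.exp_pos _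
  have hMx : c * e ≤ (1 + x) * Q := hMills x hx0
  have hQ0 : 0 < Q := by
    have : 0 < (1 + x) * Q := (mul_pos hc he0).trans_le hMx
    exact pos_of_mul_pos_right this (by linarith)
  have hee : Real.exp (-(x * x)) = e * e := by
    rw [he, ← Real.exp_add]
    congr 1
    ring
  set I := ∫ y in Set.Ici x, Real.exp (-(x * y)) ∂(μ.tilted fun y => x * id y) with hI
  set q := (k x).re - (x ^ 2 / 2 + lam * x ^ 3 / 6) with hq
  -- In the cubic zone the quartic remainder satisfies `x ^ 4 / T ^ 2 ≤ K x / T`.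
  have hqle : |q| ≤ A * K * (x / T) := by
    have h1 := H.remainder_le x (by rwa [abs_of_nonneg hx0] at hxT) x 0
      (by simp [abs_of_nonneg hx0]) (by simpa using hx0)
    have h2 : |q| ≤ ‖(k x - ((x : ℂ) ^ 2 / 2 + lam * (x : ℂ) ^ 3 / 6))‖ := by
      refine le_trans (le_of_eq ?_) (Complex.abs_re_le_norm _)
      have : ((x : ℂ) ^ 2 / 2 + lam * (x : ℂ) ^ 3 / 6) =
          ((x ^ 2 / 2 + lam * x ^ 3 / 6 : ℝ) : ℂ) := by
        push_cast
        ring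
      rw [this, Complex.sub_re, Complex.ofReal_re]
    rw [H.map_zero] at h1
    have h3 : ‖(k x - ((x : ℂ) ^ 2 / 2 + lam * (x : ℂ) ^ 3 / 6))‖ ≤ A * x ^ 3 / T ^ 2 * x := by
      simpa [abs_of_nonneg hx0] using h1
    refine h2.trans (h3.trans ?_)
    rw [div_mul_eq_mul_div, div_le_iff₀ (by positivity)]
    calc A * x ^ 3 * x ≤ A * (K * T) * x := by gcongr
      _ = A * K * (x / T) * T ^ 2 := by field_simp
  have hxT1 : x / T ≤ 1 := by
    rw [div_le_one hT0]
    linarith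
  have hAK : 0 ≤ A * K := mul_nonneg hA hK
  have hqAK : |q| ≤ A * K := hqle.trans (mul_le_of_le_one_right hAK hxT1)
  set θ := I / (e * Q) - 1 with hθ
  have hθle : |θ| ≤ C₂ * ((x + 1) / T) := by
    have h1 : |I - e * Q| ≤ 2 * (C₁ / T) * (e * e) + e * (x * (lam * x) ^ 2 * e) := by
      have h2 : Q - Qa ≤ x * (lam * x) ^ 2 * e :=
        (measureReal_gaussianReal_Ici_sub_le hx0 hxa).trans (by gcongr)
      have h3 : Qa ≤ Q := measureReal_mono (Set.Ici_subset_Ici.2 hxa)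
      have h4 : |e * Qa - e * Q| ≤ e * (x * (lam * x) ^ 2 * e) := by
        rw [← mul_sub, abs_mul, abs_of_pos he0, abs_sub_comm, abs_of_nonneg (by linarith)]
        gcongr
      rw [hee] at hdiff
      exact (abs_sub_le _ (e * Qa) _).trans (add_le_add hdiff h4)
    have h5 : x * (lam * x) ^ 2 ≤ A ^ 2 * K / T := by
      have h6 : (lam * x) ^ 2 ≤ (A * x / T) ^ 2 := by
        rw [← sq_abs]
        exact pow_le_pow_left₀ (abs_nonneg _) hlam 2
      calc x * (lam * x) ^ 2 ≤ x * (A * x / T) ^ 2 := by gcongr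
        _ = A ^ 2 * x ^ 3 / T ^ 2 := by field_simp
        _ ≤ A ^ 2 * (K * T) / T ^ 2 := by gcongr
        _ = A ^ 2 * K / T := by field_simp
    have h7 : |I - e * Q| ≤ (A ^ 2 * K + 2 * C₁) / T * (e * e) := by
      refine h1.trans ?_
      calc 2 * (C₁ / T) * (e * e) + e * (x * (lam * x) ^ 2 * e)
          ≤ 2 * (C₁ / T) * (e * e) + e * (A ^ 2 * K / T * e) := by gcongr
        _ = (A ^ 2 * K + 2 * C₁) / T * (e * e) := by ring
    have h8 : θ = (I - e * Q) / (e * Q) := by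
      rw [hθ]
      field_simp
    -- Here the Mills bound `c e ≤ (1 + x) Q` converts the error relative to `e * e` into one
    -- relative to `e * Q`; this is the origin of the factor `x + 1`.
    rw [h8, abs_div, abs_of_pos (mul_pos he0 hQ0), div_le_iff₀ (mul_pos he0 hQ0)]
    refine h7.trans ?_
    calc (A ^ 2 * K + 2 * C₁) / T * (e * e) = C₂ / T * e * (c * e) := by
          rw [hC₂]
          field_simp
      _ ≤ C₂ / T * e * ((1 + x) * Q) := by gcongr
      _ = C₂ * ((x + 1) / T) * (e * Q) := by ring
  refine ⟨Real.exp q * (1 + θ) - 1, ?_, ?_⟩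
  · have h1 : |Real.exp q - 1| ≤ A * K * (x / T) * Real.exp (A * K) := by
      have h2 := Complex.norm_exp_sub_sum_le_norm_mul_exp (q : ℂ) 1
      simp only [Finset.range_one, Finset.sum_singleton, pow_zero, Nat.factorial_zero,
        Nat.cast_one, div_one, pow_one, Complex.norm_real, Real.norm_eq_abs] at h2
      rw [← Complex.ofReal_exp, ← Complex.ofReal_one, ← Complex.ofReal_sub, Complex.norm_real,
        Real.norm_eq_abs] at h2
      exact h2.trans (by gcongr)
    have h3 : Real.exp q ≤ Real.exp (A * K) := Real.exp_le_exp.2 ((le_abs_self q).trans hqAK)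
    calc |Real.exp q * (1 + θ) - 1| = |(Real.exp q - 1) + Real.exp q * θ| := by
          congr 1
          ring
      _ ≤ |Real.exp q - 1| + Real.exp q * |θ| := by
          refine (abs_add_le _ _).trans ?_
          rw [abs_mul, abs_of_pos (Real.exp_pos q)]
      _ ≤ A * K * (x / T) * Real.exp (A * K) + Real.exp (A * K) * (C₂ * ((x + 1) / T)) := by
          gcongr
      _ ≤ A * K * ((x + 1) / T) * Real.exp (A * K) + Real.exp (A * K) * (C₂ * ((x + 1) / T)) := by
          gcongr
          linarith
      _ = Real.exp (A * K) * (A * K + C₂) * ((x + 1) / T) := by ring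
  · rw [H.measureReal_Ici_eq hxT, ← hI]
    have h1 : (k x).re = lam * x ^ 3 / 6 + q - -x ^ 2 / 2 := by
      rw [hq]
      ring
    rw [h1, Real.exp_sub, Real.exp_add, ← he, hθ]
    field_simp
    ring

/-! ### The moment generating function of the sum of the field -/

/-- A bound in `L²` gives uniform integrability by the Cauchy–Schwarz inequality, Fatou's lemma puts
the limit in `L²`, and Vitali's theorem gives convergence in `L¹`. -/
theorem integrable_and_tendsto_integral_of_eLpNorm_two_le {P : Measure Ω} [IsProbabilityMeasure P]
    {f : ℕ → Ω → ℂ} {g : Ω → ℂ} {M : NNReal} (hf : ∀ n, AEStronglyMeasurable (f n) P)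
    (hM : ∀ n, eLpNorm (f n) 2 P ≤ M) (hlim : ∀ᵐ ω ∂P, Tendsto (fun n => f n ω) atTop (𝓝 (g ω))) :
    Integrable g P ∧ Tendsto (fun n => ∫ ω, f n ω ∂P) atTop (𝓝 (∫ ω, g ω ∂P)) := by
  have hg : AEStronglyMeasurable g P := aestronglyMeasurable_of_tendsto_ae atTop hf hlim
  have hg2 : MemLp g 2 P := by
    refine ⟨hg, ?_⟩
    have h1 := Lp.eLpNorm_lim_le_liminf_eLpNorm (p := 2) hf g hlim
    have h2 : liminf (fun n => eLpNorm (f n) 2 P) atTop ≤ M :=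
      (liminf_le_liminf (Eventually.of_forall hM)).trans (by simp)
    exact (h1.trans h2).trans_lt ENNReal.coe_lt_top
  have hg1 : MemLp g 1 P := hg2.mono_exponent one_le_two
  have hui : UnifIntegrable f 1 P := by
    intro ε hε
    refine ⟨(ε / (M + 1)) ^ 2, by positivity, fun n s hs hPs => ?_⟩
    rw [eLpNorm_indicator_eq_eLpNorm_restrict hs]
    have h1 := eLpNorm_le_eLpNorm_mul_rpow_measure_univ (μ := P.restrict s) (p := 1) (q := 2)
      one_le_two (hf n).restrict
    have h2 : eLpNorm (f n) 2 (P.restrict s) ≤ M :=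
      (eLpNorm_mono_measure _ Measure.restrict_le_self).trans (hM n)
    have h3 : (P.restrict s) Set.univ ^ (1 / (1 : ENNReal).toReal - 1 / (2 : ENNReal).toReal) ≤
        ENNReal.ofReal (ε / (M + 1)) := by
      rw [Measure.restrict_apply_univ]
      have h4 : 1 / (1 : ENNReal).toReal - 1 / (2 : ENNReal).toReal = (1 / 2 : ℝ) := by norm_num
      rw [h4]
      refine (ENNReal.rpow_le_rpow hPs (by norm_num)).trans (le_of_eq ?_)
      rw [ENNReal.ofReal_rpow_of_nonneg (by positivity) (by norm_num), ← Real.sqrt_eq_rpow,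
        Real.sqrt_sq (by positivity)]
    refine h1.trans ((mul_le_mul' h2 h3).trans ?_)
    rw [← ENNReal.ofReal_coe_nnreal, ← ENNReal.ofReal_mul (NNReal.coe_nonneg M)]
    refine ENNReal.ofReal_le_ofReal ?_
    have h5 : (M : ℝ) / (M + 1) ≤ 1 := by
      rw [div_le_one (by positivity)]
      linarith
    calc (M : ℝ) * (ε / (M + 1)) = M / (M + 1) * ε := by ring
      _ ≤ 1 * ε := by gcongr
      _ = ε := one_mul ε
  have hconv := tendsto_Lp_finite_of_tendsto_ae le_rfl ENNReal.one_ne_top hf hg1 hui hlim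
  refine ⟨memLp_one_iff_integrable.1 hg1, ?_⟩
  refine tendsto_integral_of_L1' g hg (Eventually.of_forall fun n => ?_) hconv
  exact (MemLp.mono_exponent (⟨hf n, (hM n).trans_lt ENNReal.coe_lt_top⟩ : MemLp (f n) 2 P)
    one_le_two).integrable le_rfl

theorem complexMGF_sum_eq {ι : Type*} {P : Measure Ω} [IsProbabilityMeasure P] {X : ι → Ω → ℝ}
    {L : ι → ℂ → ℂ} {H : ℝ} (hX : ∀ j, Measurable (X j)) (hind : iIndepFun X P)
    (hL : ∀ j, IsCumulantGeneratingFunction (X j) P H (L j)) (s : Finset ι) {z : ℂ}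
    (hz : ‖z‖ < H) :
    complexMGF (fun ω => ∑ j ∈ s, X j ω) P z = Complex.exp (∑ j ∈ s, L j z) := by
  have h1 := (hind.precomp (g := ((↑) : s → ι)) Subtype.val_injective).integral_fun_prod_comp
    (f := fun _ (y : ℝ) => Complex.exp (z * y)) (fun j => (hX j).aemeasurable)
    (fun j => by fun_prop)
  have h2 : ∀ ω, Complex.exp (z * ((∑ j ∈ s, X j ω : ℝ) : ℂ)) =
      ∏ j : s, Complex.exp (z * (X j ω : ℂ)) := by
    intro ω
    rw [← Complex.exp_sum, ← Finset.mul_sum]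
    push_cast
    rw [Finset.sum_coe_sort s (fun j => (X j ω : ℂ))]
  rw [complexMGF]
  simp_rw [h2]
  rw [h1, ← Finset.sum_coe_sort, Complex.exp_sum]
  refine Finset.prod_congr rfl fun j _ => ?_
  exact ((hL j).exp_eq z (by simpa using hz)).symm

theorem integrable_exp_mul_sum {ι : Type*} {P : Measure Ω} [IsProbabilityMeasure P]
    {X : ι → Ω → ℝ} {L : ι → ℂ → ℂ} {H : ℝ} (hX : ∀ j, Measurable (X j)) (hind : iIndepFun X P)
    (hL : ∀ j, IsCumulantGeneratingFunction (X j) P H (L j)) (s : Finset ι) {t : ℝ}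
    (ht : |t| < H) : Integrable (fun ω => Real.exp (t * ∑ j ∈ s, X j ω)) P := by
  have h1 := hind.integrable_exp_mul_sum (t := t) hX (s := s) fun j _ => by
    refine ((hL j).integrable t (by simpa using ht)).norm.congr (ae_of_all _ fun ω => ?_)
    simp [Complex.norm_exp]
  simpa using h1

theorem tendsto_cube_atTop (d : ℕ) : Tendsto (cube d) atTop atTop := by
  refine tendsto_atTop_finset_of_monotone (fun m n hmn => ?_) fun j => ?_
  · refine Fintype.piFinset_subset _ _ fun _ => Finset.Icc_subset_Icc ?_ ?_ <;> omega
  · refine ⟨∑ i, (j i).natAbs, ?_⟩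
    simp only [cube, Fintype.mem_piFinset, Finset.mem_Icc]
    intro i
    have : (j i).natAbs ≤ ∑ i, (j i).natAbs :=
      Finset.single_le_sum (f := fun i => (j i).natAbs) (fun _ _ => Nat.zero_le _)
        (Finset.mem_univ i)
    omega

theorem IsFieldSum.aemeasurable {d : ℕ} {P : Measure Ω} {X : (Fin d → ℤ) → Ω → ℝ} {S : Ω → ℝ}
    (hS : IsFieldSum X P S) (hX : ∀ j, Measurable (X j)) : AEMeasurable S P :=
  TendstoInMeasure.aemeasurable
    (fun m => (Finset.measurable_fun_sum (cube d m) fun j _ => hX j).aemeasurable) hS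

/-- A subsequence of the cube sums converges almost surely. The radius is halved because the second
moment of `|exp (z S_m)|` is the moment generating function at `2 Re z`, bounded by `exp (∑ c j)`
when `|2 Re z| < H`. -/
theorem IsFieldSum.integrable_and_complexMGF_eq {d : ℕ} {P : Measure Ω} [IsProbabilityMeasure P]
    {X : (Fin d → ℤ) → Ω → ℝ} {S : Ω → ℝ} {L : (Fin d → ℤ) → ℂ → ℂ} {H : ℝ}
    {c : (Fin d → ℤ) → ℝ} (hS : IsFieldSum X P S) (hX : ∀ j, Measurable (X j))
    (hind : iIndepFun X P) (hL : ∀ j, IsCumulantGeneratingFunction (X j) P H (L j))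
    (hc0 : ∀ j, 0 ≤ c j) (hc : Summable c) (hLc : ∀ j, ∀ z : ℂ, ‖z‖ < H → ‖L j z‖ ≤ c j) {z : ℂ}
    (hz : ‖z‖ < H / 2) :
    Integrable (fun ω => Complex.exp (z * (S ω : ℂ))) P ∧
      complexMGF S P z = Complex.exp (∑' j, L j z) := by
  have hzH : ‖z‖ < H := by linarith [norm_nonneg z]
  obtain ⟨ns, hns, hae⟩ := TendstoInMeasure.exists_seq_tendsto_ae hS
  set f : ℕ → Ω → ℂ := fun n ω => Complex.exp (z * ((∑ j ∈ cube d (ns n), X j ω : ℝ) : ℂ)) with hf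
  have hre : |2 * z.re| < H := by
    rw [abs_mul, abs_two]
    linarith [Complex.abs_re_le_norm z]
  have hM : ∀ n, eLpNorm (f n) 2 P ≤ (Real.toNNReal (Real.exp ((∑' j, c j) / 2)) : NNReal) := by
    intro n
    have hint := integrable_exp_mul_sum hX hind hL (cube d (ns n)) hre
    have hmgf := complexMGF_sum_eq hX hind hL (cube d (ns n)) (z := ((2 * z.re : ℝ) : ℂ))
      (by simpa using hre)
    rw [complexMGF_ofReal] at hmgf
    have hle : ∫ ω, Real.exp (2 * z.re * ∑ j ∈ cube d (ns n), X j ω) ∂P ≤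
        Real.exp (∑' j, c j) := by
      have h1 : mgf (fun ω => ∑ j ∈ cube d (ns n), X j ω) P (2 * z.re) =
          Real.exp (∑ j ∈ cube d (ns n), L j ((2 * z.re : ℝ) : ℂ)).re := by
        rw [← Complex.norm_exp, ← hmgf, Complex.norm_real, Real.norm_of_nonneg mgf_nonneg]
      rw [mgf] at h1
      rw [h1]
      refine Real.exp_le_exp.2 ((Complex.re_le_norm _).trans ((norm_sum_le _ _).trans ?_))
      exact (Finset.sum_le_sum fun j _ => hLc j _ (by simpa using hre)).trans
        (hc.sum_le_tsum _ fun j _ => hc0 j)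
    have hsq : ∀ ω, ‖f n ω‖ ^ 2 = Real.exp (2 * z.re * ∑ j ∈ cube d (ns n), X j ω) := by
      intro ω
      rw [hf, Complex.norm_exp, Complex.re_mul_ofReal, ← Real.exp_nat_mul]
      congr 1
      push_cast
      ring
    have hmem : MemLp (f n) 2 P := by
      rw [memLp_two_iff_integrable_sq_norm]
      · simp_rw [hsq]
        exact hint
      · refine Measurable.aestronglyMeasurable ?_
        have := Finset.measurable_fun_sum (cube d (ns n)) fun j _ => hX j
        fun_prop
    rw [hmem.eLpNorm_eq_integral_rpow_norm two_ne_zero ENNReal.ofNat_ne_top]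
    refine ENNReal.ofReal_le_ofReal ?_
    have h2 : ∀ ω, ‖f n ω‖ ^ (2 : ENNReal).toReal = ‖f n ω‖ ^ 2 := by
      intro ω
      rw [ENNReal.toReal_ofNat, ← Real.rpow_natCast, Nat.cast_ofNat]
    simp_rw [h2, hsq]
    have h3 : Real.exp ((∑' j, c j) / 2) = Real.exp (∑' j, c j) ^ ((2 : ENNReal).toReal⁻¹) := by
      rw [← Real.exp_mul, ENNReal.toReal_ofNat]
      rfl
    rw [h3]
    exact Real.rpow_le_rpow (integral_nonneg fun ω => (Real.exp_pos _).le) hle (by positivity)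
  have hlim : ∀ᵐ ω ∂P, Tendsto (fun n => f n ω) atTop (𝓝 (Complex.exp (z * (S ω : ℂ)))) := by
    filter_upwards [hae] with ω hω
    exact (Complex.continuous_exp.tendsto _).comp
      (((Complex.continuous_ofReal.tendsto _).comp hω).const_mul z)
  have hmeas : ∀ n, AEStronglyMeasurable (f n) P := by
    intro n
    refine Measurable.aestronglyMeasurable ?_
    have := Finset.measurable_fun_sum (cube d (ns n)) fun j _ => hX j
    fun_prop
  obtain ⟨hint, htend⟩ := integrable_and_tendsto_integral_of_eLpNorm_two_le hmeas hM hlim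
  refine ⟨hint, tendsto_nhds_unique htend ?_⟩
  have hsum : Summable fun j => L j z := Summable.of_norm_bounded hc fun j => hLc j z hzH
  have h1 : Tendsto (fun n => Complex.exp (∑ j ∈ cube d (ns n), L j z)) atTop
      (𝓝 (Complex.exp (∑' j, L j z))) :=
    (Complex.continuous_exp.tendsto _).comp
      (hsum.hasSum.comp ((tendsto_cube_atTop d).comp hns.tendsto_atTop))
  refine h1.congr fun n => ?_
  exact (complexMGF_sum_eq hX hind hL (cube d (ns n)) hzH).symm

/-! ### The normalized sum of the field -/

theorem summable_cumulant_three {ι : Type*} {P : Measure Ω} {X : ι → Ω → ℝ} {L : ι → ℂ → ℂ}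
    {H : ℝ} {c : ι → ℝ} (hH : 0 < H) (hL : ∀ j, IsCumulantGeneratingFunction (X j) P H (L j))
    (hc : Summable c) (hLc : ∀ j, ∀ z : ℂ, ‖z‖ < H → ‖L j z‖ ≤ c j) :
    Summable fun j => cumulant 3 (X j) P := by
  have h := (hc.mul_left 48).div_const (H ^ 3)
  exact Summable.of_norm_bounded h fun j => (hL j).abs_cumulant_three_le hH (hLc j)

theorem abs_tsum_cumulant_three_le {ι : Type*} {P : Measure Ω} {X : ι → Ω → ℝ} {L : ι → ℂ → ℂ}
    {H : ℝ} {c : ι → ℝ} (hH : 0 < H) (hL : ∀ j, IsCumulantGeneratingFunction (X j) P H (L j))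
    (hc : Summable c) (hLc : ∀ j, ∀ z : ℂ, ‖z‖ < H → ‖L j z‖ ≤ c j) :
    |∑' j, cumulant 3 (X j) P| ≤ 48 * (∑' j, c j) / H ^ 3 := by
  have h := ((hc.hasSum.mul_left 48).div_const (H ^ 3))
  rw [← Real.norm_eq_abs]
  exact tsum_of_norm_bounded h fun j => (hL j).abs_cumulant_three_le hH (hLc j)

/-- After rescaling by `√B` the variances sum to `1` and the third cumulants to `lam`, so the
remainder of `k` is the sum of the cubic remainders of the `L j`. Summing their bounds, `∑ c j ≤ M B
H ^ 2` leaves `M / (H √B) ^ 2`. -/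
theorem IsFieldSum.hasCubicExpansion_map {d : ℕ} {P : Measure Ω} [IsProbabilityMeasure P]
    {X : (Fin d → ℤ) → Ω → ℝ} {S : Ω → ℝ} {L : (Fin d → ℤ) → ℂ → ℂ} {H B M : ℝ}
    {c : (Fin d → ℤ) → ℝ} (hS : IsFieldSum X P S) (hX : ∀ j, Measurable (X j))
    (hmean : ∀ j, ∫ ω, X j ω ∂P = 0)
    (hind : iIndepFun X P) (hL : ∀ j, IsCumulantGeneratingFunction (X j) P H (L j))
    (hc0 : ∀ j, 0 ≤ c j) (hc : Summable c) (hLc : ∀ j, ∀ z : ℂ, ‖z‖ < H → ‖L j z‖ ≤ c j)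
    (hH : 0 < H) (hB : HasSum (fun j => Var[X j; P]) B) (hB0 : 0 < B)
    (hM : ∑' j, c j ≤ M * (B * H ^ 2)) :
    HasCubicExpansion (P.map fun ω => S ω / √B) (fun z => ∑' j, L j (z / (√B : ℝ))) (H * √B)
      ((∑' j, cumulant 3 (X j) P) / B ^ (3 / 2 : ℝ)) (6144 * M) := by
  have hSm := hS.aemeasurable hX
  set b := √B with hb
  have hb0 : 0 < b := Real.sqrt_pos.2 hB0
  have hbB : b ^ 2 = B := Real.sq_sqrt hB0.le
  have hb3 : B ^ (3 / 2 : ℝ) = b ^ 3 := by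
    rw [hb, Real.sqrt_eq_rpow, ← Real.rpow_natCast, ← Real.rpow_mul hB0.le]
    norm_num
  have hbC : (b : ℂ) ≠ 0 := by exact_mod_cast hb0.ne'
  have hnorm : ∀ z : ℂ, ‖z / (b : ℂ)‖ = ‖z‖ / b := fun z => by
    rw [norm_div, Complex.norm_real, Real.norm_of_nonneg hb0.le]
  have hscale : ∀ z : ℂ, ‖z‖ < H * b / 2 → ‖z / (b : ℂ)‖ < H / 2 := by
    intro z hz
    rw [hnorm, div_lt_iff₀ hb0]
    linarith
  have hYm : AEMeasurable (fun ω => S ω / b) P := hSm.div_const b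
  have hkey := fun z hz => hS.integrable_and_complexMGF_eq hX hind hL hc0 hc hLc (z := z) hz
  set Γ := ∑' j, cumulant 3 (X j) P with hΓ
  have hc0' : 0 ≤ ∑' j, c j := tsum_nonneg hc0
  have hM0 : 0 ≤ M := nonneg_of_mul_nonneg_left (hc0'.trans hM) (by positivity)
  have hΓsum : HasSum (fun j => cumulant 3 (X j) P) Γ :=
    (summable_cumulant_three hH hL hc hLc).hasSum
  refine ⟨fun h hh => ?_, fun z hz => ?_, ?_, ?_, ?_⟩
  · rw [integrable_map_measure (by fun_prop) hYm]
    have h1 := (hkey ((h : ℂ) / b) (hscale h (by simpa using hh))).1.norm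
    refine h1.congr (ae_of_all _ fun ω => ?_)
    simp only [Function.comp_apply]
    rw [Complex.norm_exp, ← Complex.ofReal_div, Complex.re_ofReal_mul, Complex.ofReal_re]
    congr 1
    ring
  · rw [complexMGF_id_map hYm, ← (hkey (z / b) (hscale z hz)).2]
    refine integral_congr_ae (ae_of_all _ fun ω => ?_)
    simp only
    congr 1
    push_cast
    ring
  · simp [(hL _).map_zero]
  · rw [hb3, abs_div, abs_of_pos (pow_pos hb0 3), div_le_div_iff₀ (pow_pos hb0 3) (by positivity)]
    have h1 := abs_tsum_cumulant_three_le hH hL hc hLc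
    rw [← hΓ, le_div_iff₀ (by positivity)] at h1
    -- The third cumulants need only the constant `48 M`; it is enlarged so that one `A` serves both
    -- bounds.
    have h2 : |Γ| * H ≤ 6144 * M * b ^ 2 := by
      have h3 : |Γ| * H ^ 3 ≤ 48 * (M * (b ^ 2 * H ^ 2)) := by
        rw [hbB]
        linarith
      have h4 : |Γ| * H * H ^ 2 ≤ 6144 * M * b ^ 2 * H ^ 2 := by
        have : 0 ≤ M * b ^ 2 * H ^ 2 := by positivity
        nlinarith
      exact le_of_mul_le_mul_right h4 (by positivity)
    nlinarith
  · intro r hr z w hz hw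
    have hrH : r / b < H / 2 := by
      rw [div_lt_iff₀ hb0]
      linarith
    have hr0 : 0 ≤ r := (norm_nonneg z).trans hz
    have hrem : ∀ u : ℂ, ‖u‖ ≤ r → HasSum (fun j => cubicRemainder (L j) (u / b))
        (∑' j, L j (u / b) - (u ^ 2 / 2 + ((Γ / B ^ (3 / 2 : ℝ) : ℝ) : ℂ) * u ^ 3 / 6)) := by
      intro u hu
      have huH : ‖u / (b : ℂ)‖ < H := by
        rw [hnorm]
        exact (div_le_div_of_nonneg_right hu hb0.le).trans_lt (by linarith)
      have h1 : HasSum (fun j => L j (u / b)) (∑' j, L j (u / b)) :=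
        (Summable.of_norm_bounded hc fun j => hLc j _ huH).hasSum
      have h2 : HasSum (fun j => (Var[X j; P] : ℂ)) (B : ℂ) := Complex.hasSum_ofReal.2 hB
      have h3 : HasSum (fun j => (cumulant 3 (X j) P : ℂ)) (Γ : ℂ) :=
        Complex.hasSum_ofReal.2 hΓsum
      have h4 := h1.sub (((h2.div_const 2).mul_right ((u / b) ^ 2)).add
        ((h3.div_const 6).mul_right ((u / b) ^ 3)))
      have h5 : (u ^ 2 / 2 + ((Γ / B ^ (3 / 2 : ℝ) : ℝ) : ℂ) * u ^ 3 / 6) =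
          (B : ℂ) / 2 * (u / b) ^ 2 + (Γ : ℂ) / 6 * (u / b) ^ 3 := by
        rw [hb3, ← hbB]
        push_cast
        field_simp
      rw [h5]
      refine h4.congr_fun fun j => ?_
      rw [cubicRemainder, (hL j).iteratedDeriv_two_eq hH, (hL j).iteratedDeriv_three_eq hH]
    rw [← ((hrem z hz).sub (hrem w hw)).tsum_eq]
    have hbound : ∀ j, ‖cubicRemainder (L j) (z / b) - cubicRemainder (L j) (w / b)‖ ≤
        c j * (6144 / H ^ 4 * (r / b) ^ 3 * (‖z - w‖ / b)) := by
      intro j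
      have h1 := norm_cubicRemainder_sub_le hH (hc0 j) (hL j).analytic
        (fun z hz => hLc j z (by simpa using hz)) ((hL j).deriv_eq_zero hH (hmean j)) hrH
        (z := z / b) (w := w / b) (by rw [hnorm]; gcongr) (by rw [hnorm]; gcongr)
      rw [← sub_div, hnorm] at h1
      refine h1.trans (le_of_eq ?_)
      ring
    refine (tsum_of_norm_bounded (hc.hasSum.mul_right _) hbound).trans ?_
    calc (∑' j, c j) * (6144 / H ^ 4 * (r / b) ^ 3 * (‖z - w‖ / b))
        ≤ M * (B * H ^ 2) * (6144 / H ^ 4 * (r / b) ^ 3 * (‖z - w‖ / b)) := by gcongr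
      _ = 6144 * M * r ^ 3 / (H * b) ^ 2 * ‖z - w‖ := by
          rw [← hbB]
          field_simp

theorem one_sub_normalizedCDF {P : Measure Ω} [IsProbabilityMeasure P] {S : Ω → ℝ}
    (hS : AEMeasurable S P) {B : ℝ} (hB : 0 < B) (x : ℝ) :
    1 - normalizedCDF S P B x = (P.map fun ω => S ω / √B).real (Set.Ici x) := by
  have hm : AEMeasurable (fun ω => S ω / √B) P := hS.div_const _
  have : IsProbabilityMeasure (P.map fun ω => S ω / √B) := Measure.isProbabilityMeasure_map hm
  rw [← Set.compl_Iio, probReal_compl_eq_one_sub measurableSet_Iio, normalizedCDF,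
    map_measureReal_apply_of_aemeasurable hm measurableSet_Iio]
  congr 2
  ext ω
  simp only [Set.mem_ofPred_eq, Set.mem_preimage, Set.mem_Iio]
  rw [div_lt_iff₀ (Real.sqrt_pos.2 hB)]

end RandomFieldCramer

/-! ### The large deviation relation for the field -/

theorem mainTheorem3 {Ω : Type*} [MeasurableSpace Ω] (P : Measure Ω) [IsProbabilityMeasure P]
    (d : ℕ) (X : ℕ → (Fin d → ℤ) → Ω → ℝ) (S : ℕ → Ω → ℝ)
    (H : ℕ → ℝ) (B : ℕ → ℝ) (c : ℕ → (Fin d → ℤ) → ℝ)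
    (hX_meas : ∀ n j, Measurable (X n j))
    (hX_mean : ∀ n j, ∫ ω, X n j ω ∂P = 0)
    (hX_indep : ∀ n, iIndepFun (X n) P)
    (hS : ∀ n, RandomFieldCramer.IsFieldSum (X n) P (S n))
    (hB_summable : ∀ n, Summable fun j => Var[X n j; P])
    (hB : ∀ n, B n = RandomFieldCramer.totalVariance (X n) P)
    (hH : ∀ n, 0 < H n)
    (hc : ∀ n j, 0 ≤ c n j)
    (hL : ∀ n j, ∃ L : ℂ → ℂ,
      RandomFieldCramer.IsCumulantGeneratingFunction (X n j) P (H n) L ∧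
        ∀ z : ℂ, ‖z‖ < H n → ‖L z‖ ≤ c n j)
    (hBH : Tendsto (fun n => B n * H n ^ 2) atTop atTop)
    (hc_summable : ∀ n, Summable (c n))
    (hC : (fun n => ∑' j, c n j) =O[atTop] fun n => B n * H n ^ 2) :
    (∀ n, Summable fun j => RandomFieldCramer.cumulant 3 (X n j) P) ∧
    ∀ K : ℝ, ∃ C : ℝ, ∀ᶠ n in atTop, ∀ x : ℝ, 0 ≤ x →
      x ≤ K * (H n * √(B n)) ^ (1 / 3 : ℝ) →
      ∃ r : ℝ, |r| ≤ C * ((x + 1) / (H n * √(B n))) ∧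
        (1 - RandomFieldCramer.normalizedCDF (S n) P (B n) x) /
            (1 - RandomFieldCramer.stdNormalCDF x) =
          Real.exp (x ^ 3 / (6 * B n ^ (3 / 2 : ℝ)) *
            ∑' j, RandomFieldCramer.cumulant 3 (X n j) P) * (1 + r) := by
  choose L hLcgf hLc using hL
  refine ⟨fun n => RandomFieldCramer.summable_cumulant_three (hH n) (hLcgf n) (hc_summable n)
    (hLc n), fun K => ?_⟩
  obtain ⟨M, hM0, hM⟩ := hC.exists_nonneg
  -- The zone `x ≤ K T ^ (1/3)` becomes `x ^ 3 ≤ |K| ^ 3 T`; the absolute value covers negative `K`.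
  -- Both constants depend only on `M` and `K`, whence the uniformity in `n` and `x`.
  obtain ⟨C, T₀, hT₀, hmain⟩ := RandomFieldCramer.exists_measureReal_Ici_div_eq
    (A := 6144 * M) (K := |K| ^ 3) (by positivity) (by positivity)
  refine ⟨C, ?_⟩
  filter_upwards [hM.bound, hBH.eventually_ge_atTop (T₀ ^ 2)] with n hMn hTn x hx0 hx
  have hBH0 : 0 < B n * H n ^ 2 := (pow_pos hT₀ 2).trans_le hTn
  have hB0 : 0 < B n := pos_of_mul_pos_left hBH0 (by positivity)
  have hT0 : 0 < H n * √(B n) := mul_pos (hH n) (Real.sqrt_pos.2 hB0)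
  have hTT : T₀ ≤ H n * √(B n) := by
    refine le_of_sq_le_sq ?_ hT0.le
    rwa [mul_pow, Real.sq_sqrt hB0.le, mul_comm]
  have hMn' : ∑' j, c n j ≤ M * (B n * H n ^ 2) := by
    rw [Real.norm_of_nonneg hBH0.le] at hMn
    exact (le_abs_self _).trans hMn
  have hBsum : HasSum (fun j => Var[X n j; P]) (B n) := by
    rw [hB n]
    exact (hB_summable n).hasSum
  have hexp := (hS n).hasCubicExpansion_map (hX_meas n) (hX_mean n) (hX_indep n) (hLcgf n) (hc n)
    (hc_summable n) (hLc n) (hH n) hBsum hB0 hMn'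
  have hSm := (hS n).aemeasurable (hX_meas n)
  have hprob : IsProbabilityMeasure (P.map fun ω => S n ω / √(B n)) :=
    Measure.isProbabilityMeasure_map (hSm.div_const _)
  have hx3 : x ^ 3 ≤ |K| ^ 3 * (H n * √(B n)) := by
    have h1 : x ≤ |K| * (H n * √(B n)) ^ (1 / 3 : ℝ) :=
      hx.trans (mul_le_mul_of_nonneg_right (le_abs_self K) (by positivity))
    have h2 : ((H n * √(B n)) ^ (1 / 3 : ℝ)) ^ 3 = H n * √(B n) := by
      rw [← Real.rpow_natCast, ← Real.rpow_mul hT0.le]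
      norm_num
    calc x ^ 3 ≤ (|K| * (H n * √(B n)) ^ (1 / 3 : ℝ)) ^ 3 := pow_le_pow_left₀ hx0 h1 3
      _ = |K| ^ 3 * (H n * √(B n)) := by rw [mul_pow, h2]
  obtain ⟨r, hr, heq⟩ := hmain _ _ _ _ x hexp hTT hx0 hx3
  refine ⟨r, hr, ?_⟩
  rw [RandomFieldCramer.one_sub_normalizedCDF hSm hB0, RandomFieldCramer.one_sub_stdNormalCDF, heq]
  congr 2
  ring
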